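/- Let $\Omega\subset\mathbb R^2$ be a bounded convex open set with polygonal boundary and let $\mathcal T$ be a conformal triangle mesh of $\Omega$ (finitely many non-degenerate closed triangles that cover $\overline\Omega$, two different ones meeting exactly along the convex hull of their common vertices). For a triangle $K$ with area $|K|$ let $W_{K,i}$, $i=1,2,3$, be its vertices, $\theta_{K,i}$ the angle at $W_{K,i}$ and $a_{K,i}$ the edge opposite to $W_{K,i}$, with length $|a_{K,i}|$. For every edge $a$ a unit normal $n_a$ is chosen, pointing outwards $\Omega$ if $a\subset\partial\Omega$. For an internal edge $a$ (one that is not contained in $\partial\Omega$) write $\partial^c a=(K,L)$ if $a$ is an edge of $K$ and of $L$ and $n_a$ points from $K$ towards $L$; for a boundary edge of $K$ write $\partial^c a=(K)$; $\theta_{a,K}$ is the angle of $K$ opposite to $a$. To a family $(\psi_{K,i})$ of vector fields one associates $\psi_a=\psi_{K,i}-\psi_{L,j}$ if $\partial^c a=(K,L)$, $a=a_{K,i}=a_{L,j}$, and $\psi_a=\psi_{K,i}$ if $\partial^c a=(K)$, $a=a_{K,i}$. The Raviart–Thomas basis $(\varphi_a)$ is associated in this way to the fields $\varphi_{K,i}(x)=(x-W_{K,i})/(2|K|)$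 on $K$, extended by $0$; its span is $RT$. $P^0$ is the space of functions that are constant on every triangle, $(\cdot,\cdot)_0$ is the $L^2(\Omega)$ scalar product. A family $(\varphi^\star_a)$ is a Raviart–Thomas dual basis if, for all edges $a,b$, $\varphi_a^\star\in H(\mathrm{div},\Omega)$, $(\varphi^\star_a,\varphi_a)_0\ne0$, $(\varphi^\star_a,\varphi_b)_0=0$ for $a\ne b$, $\mathrm{supp}\,\varphi_a^\star\subset\mathrm{supp}\,\varphi_a$ and $\int_b\varphi_a^\star\cdot n_b\,ds=\delta_{ab}$. Assume that all angles satisfy $0<\theta_{K,i}<\pi/2$. Let $g$ be an integrable function on $(0,1)$ with $\int_0^1g\,ds=1$, $\int_0^1g(s)s^2\,ds=0$ and $g(s)=g(1-s)$, and let $g_{K,i}$ be the function on $a_{K,i}$ with value $g(s)/|a_{K,i}|$ at the point $sS+(1-s)N$, where $S,N$ are the endpoints of $a_{K,i}$. For every $K$ let $\delta_K\in L^2(K)$ satisfy $\int_K\delta_K\,dx=1$ and $\int_K\delta_K(x)|x-W_{K,i}|^2\,dx=0$ for $i=1,2,3$. Let $(\varphi^\star_{K,i})$ be square-integrable vector fields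 on $\Omega$ such that $\varphi^\star_{K,i}=0$ outside $K$, $\mathrm{div}\,\varphi^\star_{K,i}=\delta_K$ in $K$, and the outward normal trace of $\varphi^\star_{K,i}$ on $\partial K$ is $g_{K,i}$ on $a_{K,i}$ and $0$ on the two other edges. Let $(\varphi_a^\star)$ be the associated family. Then: (1) $(\varphi^\star_a)$ is a Raviart–Thomas dual basis. (2) $(\varphi_a,\varphi_a^\star)_0=(\cot\theta_{a,K}+\cot\theta_{a,L})/2$ if $\partial^ca=(K,L)$, and $(\varphi_a,\varphi_a^\star)_0=\cot\theta_{a,K}/2$ if $\partial^ca=(K)$. (3) Let $f\in L^2(\Omega)$ and $RT^\star=\mathrm{span}(\varphi^\star_a)$. The mixed Petrov–Galerkin problem: find $(u,p)\in P^0\times RT$ such that $(p,q)_0+(u,\mathrm{div}\,q)_0=0$ and $-(\mathrm{div}\,p,v)_0=(f,v)_0$ for all $(v,q)\in P^0\times RT^\star$, has a unique solution. It is equivalent to $p=\nabla_{\mathcal T}u$, $-\mathrm{div}(\nabla_{\mathcal T}u)=f_{\mathcal T}$ with $u\in P^0$; here $f_{\mathcal T}=\sum_K\bigl(\frac1{|K|}\int_Kf\,dx\bigr)\mathbf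 1_K$ and, $\Pi:RT\to RT^\star$ being the linear map with $\Pi\varphi_a=\varphi^\star_a$, $\nabla_{\mathcal T}u\in RT$ is defined by $(\Pi\nabla_{\mathcal T}u,q)_0=-(u,\mathrm{div}\,q)_0$ for all $q\in RT$. It coincides with the VF4 finite volume scheme: $u=\sum_Ku_K\mathbf 1_K$ and $p=\sum_ap_a\varphi_a$ solve it if and only if the numbers $F_{K,i}=-(n_a\cdot n_{K,i})\,p_a$, where $a=a_{K,i}$ and $n_{K,i}$ is the unit normal of $a_{K,i}$ outwards $K$, satisfy $\sum_{i=1}^3F_{K,i}=\int_Kf\,dx$ for every $K$, $F_{K,i}=-|a|\,(u_L-u_K)/|x_K-x_L|$ if $a$ is also an edge of $L\neq K$, and $F_{K,i}=|a|\,u_K/\mathrm{dist}(x_K,a)$ if $a\subset\partial\Omega$, where $x_K$ is the circumcenter of $K$. -/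

import Mathlib

open MeasureTheory Set
open scoped ContDiff RealInnerProductSpace

noncomputable section

namespace RTPG

/-- The Euclidean plane. -/
abbrev Plane := EuclideanSpace ℝ (Fin 2)

/-! ### Function spaces -/

/-- The `L²(Ω)` scalar product `(p, q)₀`, for scalar functions and for vector fields. -/
def l2 {F : Type*} [NormedAddCommGroup F] [InnerProductSpace ℝ F]
    (Ω : Set Plane) (p q : Plane → F) : ℝ :=
  ∫ x in Ω, ⟪p x, q x⟫

/-- `d` is the weak divergence of the field `p` in the open set `U`. -/
def IsWeakDiv (U : Set Plane) (p : Plane → Plane) (d : Plane → ℝ) : Prop :=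
  ∀ v : Plane → ℝ, ContDiff ℝ ∞ v → HasCompactSupport v → tsupport v ⊆ U →
    ∫ x in U, ⟪p x, gradient v x⟫ = -∫ x in U, d x * v x

/-- `p` belongs to `H(div, U)`. -/
def MemHDiv (U : Set Plane) (p : Plane → Plane) : Prop :=
  MemLp p 2 (volume.restrict U) ∧
    ∃ d : Plane → ℝ, MemLp d 2 (volume.restrict U) ∧ IsWeakDiv U p d

open Classical in
/-- The divergence operator on `H(div, U)` (a representative; it is unique almost everywhere
in `U`). -/
def div (U : Set Plane) (p : Plane → Plane) : Plane → ℝ :=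
  if h : ∃ d : Plane → ℝ, MemLp d 2 (volume.restrict U) ∧ IsWeakDiv U p d
  then h.choose else 0

/-- The support in `Ω` of a field that is known up to null sets. -/
def essSupport (Ω : Set Plane) (p : Plane → Plane) : Set Plane :=
  {x | ∀ U ∈ nhds x, ¬ (∀ᵐ y ∂(volume.restrict (U ∩ Ω)), p y = 0)}

/-- The closed triangle. -/
def hull (Q : Affine.Triangle ℝ Plane) : Set Plane := convexHull ℝ (range Q.points)

/-- The length of the edge opposite to the vertex `i`. -/
def edgeLength (Q : Affine.Triangle ℝ Plane) (i : Fin 3) : ℝ :=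
  dist (Q.points (i + 1)) (Q.points (i + 2))

/-- The point of parameter `s` on the edge opposite to the vertex `i`. -/
def edgePoint (Q : Affine.Triangle ℝ Plane) (i : Fin 3) (s : ℝ) : Plane :=
  s • Q.points (i + 1) + (1 - s) • Q.points (i + 2)

/-- The field `p` on the triangle `Q` has a divergence in `L²(Q)` and its outward normal trace
`p · n` on the boundary of `Q` is the integrable function whose value at the point of parameter `s`
of the edge `i` is `γ i s`. As usual, the normal trace is defined through the Green formula. -/
def HasNormalTrace (Q : Affine.Triangle ℝ Plane) (p : Plane → Plane) (γ : Fin 3 → ℝ → ℝ) : Prop :=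
  (∀ i, IntervalIntegrable (γ i) volume 0 1) ∧
    ∃ d : Plane → ℝ, MemLp d 2 (volume.restrict (interior (hull Q))) ∧
      IsWeakDiv (interior (hull Q)) p d ∧
      ∀ v : Plane → ℝ, ContDiff ℝ ∞ v →
        (∫ x in interior (hull Q), ⟪p x, gradient v x⟫) + (∫ x in interior (hull Q), d x * v x) =
          ∑ i, edgeLength Q i * ∫ s in (0 : ℝ)..1, γ i s * v (edgePoint Q i s)

/-! ### Meshes -/

/-- A conformal triangle mesh of the domain `Ω`, with a finite set `T` of triangles: the triangles
cover the closure of `Ω`, and two different triangles meet exactly along the convex hull of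
their common vertices (nothing, a vertex or a whole edge). -/
structure TriMesh (T : Type*) [Fintype T] (Ω : Set Plane) where
  tri : T → Affine.Triangle ℝ Plane
  cover : ⋃ K, hull (tri K) = closure Ω
  vertices_injective : Function.Injective fun K => range (tri K).points
  conformal : ∀ K L, K ≠ L →
    hull (tri K) ∩ hull (tri L) = convexHull ℝ (range (tri K).points ∩ range (tri L).points)

namespace TriMesh

variable {T : Type*} [Fintype T] {Ω : Set Plane} (M : TriMesh T Ω)

/-- The closed triangle `K`. -/
def cell (K : T) : Set Plane := hull (M.tri K)

/-- The area `|K|`. -/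
def area (K : T) : ℝ := volume.real (M.cell K)

/-- The vertex `W_{K,i}`. -/
def W (K : T) (i : Fin 3) : Plane := (M.tri K).points i

/-- The angle `θ_{K,i}` of `K` at the vertex `W_{K,i}`. -/
def θ (K : T) (i : Fin 3) : ℝ :=
  EuclideanGeometry.angle (M.W K (i + 1)) (M.W K i) (M.W K (i + 2))

/-- The set of the edges of the mesh; an edge is given by the unordered pair of its endpoints. -/
def Edge : Type := {a : Sym2 Plane // ∃ K i, s(M.W K (i + 1), M.W K (i + 2)) = a}

/-- The edge `a_{K,i}` of `K`, opposite to the vertex `W_{K,i}`. -/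
def edge (K : T) (i : Fin 3) : M.Edge := ⟨s(M.W K (i + 1), M.W K (i + 2)), K, i, rfl⟩

theorem edge_surjective : Function.Surjective fun q : T × Fin 3 => M.edge q.1 q.2 := by
  rintro ⟨a, K, i, rfl⟩
  exact ⟨(K, i), rfl⟩

instance : Finite M.Edge := Finite.of_surjective _ M.edge_surjective

instance : Fintype M.Edge := Fintype.ofFinite _

/-- The edge as a closed segment of the plane. -/
def seg (a : M.Edge) : Set Plane := convexHull ℝ {x | x ∈ a.1}

/-- Boundary edges; the other edges are the internal ones. -/
def IsBoundary (a : M.Edge) : Prop := M.seg a ⊆ frontier Ω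

/-- The indicator function of the triangle `K`. -/
def ind (K : T) : Plane → ℝ := (M.cell K).indicator 1

/-- The space `P⁰` of the piecewise constant functions. -/
def P0 : Submodule ℝ (Plane → ℝ) := Submodule.span ℝ (range M.ind)

/-- The projection `f_T` of `f` on `P⁰`. -/
def proj (f : Plane → ℝ) : Plane → ℝ :=
  ∑ K, ((M.area K)⁻¹ * ∫ x in M.cell K, f x) • M.ind K

/-- The local Raviart-Thomas basis function `φ_{K,i} = ∇|x - W_{K,i}|² / (4|K|)` on `K`,
extended by zero. Its flux through `a_{K,i}` is one and its divergence in `K` is `1/|K|`. -/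
def localRT (K : T) (i : Fin 3) : Plane → Plane :=
  (M.cell K).indicator fun x => (2 * M.area K)⁻¹ • (x - M.W K i)

/-- The circumcenter of the triangle `K`. -/
def center (K : T) : Plane := (M.tri K).circumcenter

/-- The classical `VF4` finite volume scheme for `-Δu = f`, `u = 0` on the boundary, with unknowns
`U K` at the circumcenters of the triangles: `F K i` is the numerical flux through the edge
`a_{K,i}`, outwards `K`, which approximates the integral of `-∇u · n_{K,i}`. -/
def IsVF4 (f : Plane → ℝ) (U : T → ℝ) (F : T → Fin 3 → ℝ) : Prop :=
  (∀ K i L j, K ≠ L → M.edge K i = M.edge L j →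
    F K i = -(edgeLength (M.tri K) i * ((U L - U K) / dist (M.center K) (M.center L)))) ∧
  (∀ K i, M.IsBoundary (M.edge K i) →
    F K i = -(edgeLength (M.tri K) i *
      ((0 - U K) / Metric.infDist (M.center K) (M.seg (M.edge K i))))) ∧
  ∀ K, ∑ i, F K i = ∫ x in M.cell K, f x

end TriMesh

/-- A choice of a unit normal `n_a` for every edge `a`, which points outwards `Ω` if `a` is
a boundary edge. -/
structure EdgeNormals {T : Type*} [Fintype T] {Ω : Set Plane} (M : TriMesh T Ω) where
  n : M.Edge → Plane
  norm_n : ∀ a, ‖n a‖ = 1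
  orthogonal : ∀ K i, ⟪n (M.edge K i), M.W K (i + 1) - M.W K (i + 2)⟫ = 0
  boundary : ∀ K i, M.IsBoundary (M.edge K i) → 0 < ⟪n (M.edge K i), M.W K (i + 1) - M.W K i⟫

namespace EdgeNormals

variable {T : Type*} [Fintype T] {Ω : Set Plane} {M : TriMesh T Ω} (N : EdgeNormals M)

/-- The chosen normal of the edge `a_{K,i}` points outwards `K`. -/
def PointsOut (K : T) (i : Fin 3) : Prop := 0 < ⟪N.n (M.edge K i), M.W K (i + 1) - M.W K i⟫

open Classical in
/-- The sign `n_a · n_{K,i}`, where `a = a_{K,i}` and `n_{K,i}` is the unit outward normal. -/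
def ε (K : T) (i : Fin 3) : ℝ := if N.PointsOut K i then 1 else -1

/-- `a` is an internal edge, `a = a_{K,i} = a_{L,j}`, and `n_a` points from `K` towards `L`;
that is, `∂ᶜ a = (K, L)`. -/
def IsInnerCoboundary (a : M.Edge) (K : T) (i : Fin 3) (L : T) (j : Fin 3) : Prop :=
  ¬ M.IsBoundary a ∧ M.edge K i = a ∧ M.edge L j = a ∧ N.PointsOut K i ∧ ¬ N.PointsOut L j

open Classical in
/-- The family assembled from the local family `ψ`: it is `ψ_{K,i} - ψ_{L,j}` on an internal edge
`a = a_{K,i} = a_{L,j}` whose normal points from `K` towards `L`, and `ψ_{K,i}` on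
a boundary edge `a = a_{K,i}`. -/
def assemble (ψ : T → Fin 3 → Plane → Plane) (a : M.Edge) : Plane → Plane :=
  ∑ K, ∑ i, if M.edge K i = a then N.ε K i • ψ K i else 0

/-- The Raviart-Thomas basis. -/
def φ : M.Edge → Plane → Plane := N.assemble M.localRT

/-- The Raviart-Thomas space of order `0`. -/
def RT : Submodule ℝ (Plane → Plane) := Submodule.span ℝ (range N.φ)

/-- The flux of `p` through the edge `b` is well defined and is equal to `c`, that is
`∫_b p · n_b = c` (from both sides if `b` is an internal edge). -/
def HasFlux (p : Plane → Plane) (b : M.Edge) (c : ℝ) : Prop :=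
  ∀ K i, M.edge K i = b → ∃ γ : Fin 3 → ℝ → ℝ, HasNormalTrace (M.tri K) p γ ∧
    N.ε K i * (edgeLength (M.tri K) i * ∫ s in (0 : ℝ)..1, γ i s) = c

open Classical in
/-- Raviart-Thomas dual bases. -/
structure IsDualBasis (φs : M.Edge → Plane → Plane) : Prop where
  memHDiv : ∀ a, MemHDiv Ω (φs a)
  ne_zero : ∀ a, l2 Ω (φs a) (N.φ a) ≠ 0
  orthogonal : ∀ a b, a ≠ b → l2 Ω (φs a) (N.φ b) = 0
  localized : ∀ a, essSupport Ω (φs a) ⊆ essSupport Ω (N.φ a)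
  flux : ∀ a b, N.HasFlux (φs a) b (if a = b then 1 else 0)

/-- `(u, p)` solves the mixed Petrov-Galerkin discretization of `-Δu = f`, `u = 0` on the boundary,
with the trial space `P⁰ × RT` and the test space `P⁰ × RT*`, where `RT*` is spanned by `φs`. -/
def IsPetrovGalerkin (φs : M.Edge → Plane → Plane) (f u : Plane → ℝ) (p : Plane → Plane) : Prop :=
  u ∈ M.P0 ∧ p ∈ N.RT ∧
    ∀ v ∈ M.P0, ∀ q ∈ Submodule.span ℝ (range φs),
      l2 Ω p q + l2 Ω u (div Ω q) = 0 ∧ -l2 Ω (div Ω p) v = l2 Ω f v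

/-- `p = ∇_T u`, where the discrete gradient is `∇_T = -Π⁻¹ div*`: here `Π φ_a = φ*_a`, and
`div* u` is the element of `RT*` such that `(div* u, q)₀ = (u, div q)₀` for all `q` in `RT`. -/
def IsDiscreteGradient (φs : M.Edge → Plane → Plane) (u : Plane → ℝ) (p : Plane → Plane) : Prop :=
  ∃ P : M.Edge → ℝ, p = ∑ a, P a • N.φ a ∧
    ∀ q ∈ N.RT, l2 Ω (∑ a, P a • φs a) q = -l2 Ω u (div Ω q)

/-- The discrete problem `∇_T u = p`, `-div (∇_T u) = f_T`. -/
def IsDiscretePoisson (φs : M.Edge → Plane → Plane) (f u : Plane → ℝ) (p : Plane → Plane) : Prop :=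
  u ∈ M.P0 ∧ N.IsDiscreteGradient φs u p ∧
    ∀ᵐ x ∂(volume.restrict Ω), -div Ω p x = M.proj f x

end EdgeNormals

end RTPG

end

open RTPG

/-! On a triangle `K` the Raviart-Thomas field of the vertex `W_{K,j}` is the gradient of `|x -
W_{K,j}|² / (4|K|)`. The Green formula therefore turns its product with a local dual field into a
moment of `δ K`, which vanishes by hypothesis, plus a moment of `g` along one edge. Symmetry gives
`g` the first moment 1/2; with mass 1 and second moment 0, the edge moment vanishes for `j ≠ i`, and
for `j = i` it is the inner product of the two sides at the vertex, hence a cotangent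
(`integral_mul_norm_edgePoint_sub_sq`, `l2_localRT_self`). The pairing of `RT*` with `RT` is thus
diagonal in the edge bases (`l2_combine_combine`), and acute angles make its diagonal `stiff`
positive.

Assembled fields lie in `H(div)` because the edge terms of the Green formulas cancel: the two
triangles of an internal edge lie on opposite sides of it (`bary_W_neg`), so their signs are
opposite (`ε_eq_neg`), and the symmetry of `g` makes the two parametrizations of the edge equivalent
(`isWeakDiv_combine`). The Raviart-Thomas fields are themselves a `LocalFamily`, with `g = 1`, so
the same lemmas serve both spaces.

In coordinates, the Petrov-Galerkin problem and the discrete Poisson problem become the same system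
`IsSolution`: one equation per edge linking `P a` to the jump of `U`, and one flux balance per
triangle. Eliminating `P` leaves a square system, injective by an energy identity together with
`eq_zero_of_jump_eq_zero`. Finally the circumcenter lies on the perpendicular bisector of each edge,
at distance `|a| cot θ / 2` from it, so the distances of the VF4 scheme are `|a|` times `stiff`
(`dist_center`, `infDist_center`) and the edge equations are the VF4 fluxes. -/

namespace RTPG

noncomputable section

/-! ### Plane geometry -/

/-- The determinant of two vectors of the plane. -/
def cross (u v : Plane) : ℝ := u 0 * v 1 - u 1 * v 0

theorem inner_plane (u v : Plane) : ⟪u, v⟫ = u 0 * v 0 + u 1 * v 1 := by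
  simp [PiLp.inner_apply, Fin.sum_univ_two, mul_comm]

theorem cross_sq (u v : Plane) : cross u v ^ 2 = ⟪u, u⟫ * ⟪v, v⟫ - ⟪u, v⟫ * ⟪u, v⟫ := by
  simp only [inner_plane, cross]; ring

theorem abs_cross_eq_sin (u v : Plane) :
    |cross u v| = Real.sin (InnerProductGeometry.angle u v) * (‖u‖ * ‖v‖) := by
  rw [InnerProductGeometry.sin_angle_mul_norm_mul_norm, ← cross_sq, Real.sqrt_sq_eq_abs]

theorem cot_angle_eq (u v : Plane) (h : cross u v ≠ 0) :
    Real.cot (InnerProductGeometry.angle u v) = ⟪u, v⟫ / |cross u v| := by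
  have h1 := abs_cross_eq_sin u v
  have h2 := InnerProductGeometry.cos_angle_mul_norm_mul_norm u v
  have h3 : |cross u v| ≠ 0 := abs_ne_zero.2 h
  have h4 : ‖u‖ * ‖v‖ ≠ 0 := fun h0 => h3 (by rw [h1, h0, mul_zero])
  rw [Real.cot_eq_cos_div_sin, ← h2, h1, mul_div_mul_right _ _ h4]

theorem norm_mul_abs_inner_eq (n e w : Plane) (hn : ‖n‖ = 1) (hne : ⟪n, e⟫ = 0) :
    ‖e‖ * |⟪n, w⟫| = |cross e w| := by
  have h1 : n 0 * n 0 + n 1 * n 1 = 1 := by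
    rw [← inner_plane, real_inner_self_eq_norm_sq, hn, one_pow]
  rw [inner_plane] at hne
  rw [← sq_eq_sq₀ (by positivity) (abs_nonneg _), mul_pow, sq_abs, sq_abs,
    ← real_inner_self_eq_norm_sq, inner_plane, inner_plane, cross]
  -- Being orthogonal to the unit vector `n`, `e` is a multiple of the quarter turn `(-n 1, n 0)`;
  -- the factor is named `c` below.
  have h2 : e 0 = -n 1 * (n 0 * e 1 - n 1 * e 0) := by linear_combination (n 0) * hne - (e 0) * h1
  have h3 : e 1 = n 0 * (n 0 * e 1 - n 1 * e 0) := by linear_combination (n 1) * hne - (e 1) * h1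
  generalize n 0 * e 1 - n 1 * e 0 = c at h2 h3
  rw [h2, h3]
  linear_combination (c ^ 2 * (n 0 * w 0 + n 1 * w 1) ^ 2) * h1

theorem eq_zero_of_inner_eq_zero (n u v : Plane) (huv : cross u v ≠ 0) (hu : ⟪n, u⟫ = 0)
    (hv : ⟪n, v⟫ = 0) : n = 0 := by
  rw [inner_plane] at hu hv
  rw [cross] at huv
  have h0 : n 0 = 0 := by
    apply (mul_eq_zero.1 _).resolve_right huv
    linear_combination (v 1) * hu - (u 1) * hv
  have h1 : n 1 = 0 := by
    apply (mul_eq_zero.1 _).resolve_right huv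
    linear_combination (u 0) * hv - (v 0) * hu
  ext k; fin_cases k <;> simpa

theorem eq_inner_smul_of_inner_eq_zero (n e z : Plane) (hn : ‖n‖ = 1) (he : e ≠ 0)
    (hne : ⟪n, e⟫ = 0) (hz : ⟪z, e⟫ = 0) : z = ⟪n, z⟫ • n := by
  have h1 : ⟪n, n⟫ = 1 := by rw [real_inner_self_eq_norm_sq, hn, one_pow]
  have hc : cross n e ≠ 0 := by
    intro h
    have := cross_sq n e
    rw [h, h1, hne] at this
    apply he
    rw [← inner_self_eq_zero (𝕜 := ℝ)]
    linarith
  rw [← sub_eq_zero]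
  apply eq_zero_of_inner_eq_zero _ n e hc
  · rw [inner_sub_left, inner_smul_left, h1, real_inner_comm z n]; simp
  · rw [inner_sub_left, inner_smul_left, hz, hne]; simp

/-- Jacobian determinant of a map whose two partial derivatives are `a` and `b`, used for the change
of variables on a triangle. -/
theorem det_smulRight_add_smulRight (a b : Plane) :
    ((EuclideanSpace.proj (0 : Fin 2) : Plane →L[ℝ] ℝ).smulRight a +
      (EuclideanSpace.proj (1 : Fin 2) : Plane →L[ℝ] ℝ).smulRight b).det = cross a b := by
  rw [ContinuousLinearMap.det, ← LinearMap.det_toMatrix (EuclideanSpace.basisFun (Fin 2) ℝ).toBasis,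
    Matrix.det_fin_two]
  simp [LinearMap.toMatrix_apply, cross]
  ring

/-! ### Triangles -/

variable (Q : Affine.Triangle ℝ Plane)

theorem add_one_ne (i : Fin 3) : i + 1 ≠ i := by fin_cases i <;> decide

theorem add_two_ne (i : Fin 3) : i + 2 ≠ i := by fin_cases i <;> decide

theorem add_one_ne_add_two (i : Fin 3) : i + 1 ≠ i + 2 := by fin_cases i <;> decide

theorem eq_or_eq_or_eq (i k : Fin 3) : k = i ∨ k = i + 1 ∨ k = i + 2 := by
  revert i k; decide

/-- Indices are cyclic in `Fin 3`, so any vertex can be singled out without a case distinction later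
on. -/
theorem sum_univ_rotate {α : Type*} [AddCommMonoid α] (i : Fin 3) (f : Fin 3 → α) :
    ∑ k, f k = f i + f (i + 1) + f (i + 2) := by
  rw [Fin.sum_univ_three]
  fin_cases i
  · rfl
  · simp only [Fin.mk_one, Fin.isValue, Fin.reduceAdd]; abel
  · simp only [Fin.reduceFinMk, Fin.isValue, Fin.reduceAdd]; abel

/-- The vertices of a triangle as an affine basis of the plane. -/
def vertexBasis : AffineBasis (Fin 3) ℝ Plane :=
  ⟨Q.points, Q.independent, by
    rw [Q.independent.affineSpan_eq_top_iff_card_eq_finrank_add_one]; simp⟩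

/-- The barycentric coordinate of the vertex `i`. -/
def bary (i : Fin 3) : Plane →ᵃ[ℝ] ℝ := (vertexBasis Q).coord i

theorem bary_points (i k : Fin 3) : bary Q i (Q.points k) = if i = k then 1 else 0 :=
  (vertexBasis Q).coord_apply i k

theorem bary_self (i : Fin 3) : bary Q i (Q.points i) = 1 := by simp [bary_points]

theorem bary_of_ne {i k : Fin 3} (h : i ≠ k) : bary Q i (Q.points k) = 0 := by
  simp [bary_points, h]

theorem sum_bary (x : Plane) : ∑ k, bary Q k x = 1 := (vertexBasis Q).sum_coord_apply_eq_one x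

theorem sum_bary_smul (x : Plane) : ∑ k, bary Q k x • Q.points k = x :=
  (vertexBasis Q).linear_combination_coord_eq_self x

theorem continuous_bary (k : Fin 3) : Continuous (bary Q k) :=
  (bary Q k).continuous_of_finiteDimensional

theorem mem_hull_iff {x : Plane} : x ∈ hull Q ↔ ∀ k, 0 ≤ bary Q k x := by
  have := (vertexBasis Q).convexHull_eq_nonneg_coord
  change hull Q = _ at this
  rw [this]; rfl

theorem mem_interior_hull_iff {x : Plane} : x ∈ interior (hull Q) ↔ ∀ k, 0 < bary Q k x := by
  have := (vertexBasis Q).interior_convexHull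
  change interior (hull Q) = _ at this
  rw [this]; rfl

theorem bary_combo (k : Fin 3) (a b c : ℝ) (x y z : Plane) (h : a + b + c = 1) :
    bary Q k (a • x + b • y + c • z) = a * bary Q k x + b * bary Q k y + c * bary Q k z := by
  have h1 : ∀ v, bary Q k v = (bary Q k).linear v + bary Q k 0 := fun v => by
    have := (bary Q k).map_vadd 0 v
    simpa using this
  rw [h1 (_ + _), h1 x, h1 y, h1 z]
  simp only [map_add, map_smul, smul_eq_mul]
  linear_combination (-(bary Q k 0)) * h

theorem bary_add_smul_sub (k : Fin 3) (t : ℝ) (x y : Plane) :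
    bary Q k (x + t • (y - x)) = (1 - t) * bary Q k x + t * bary Q k y := by
  have := bary_combo Q k (1 - t) t 0 x y y (by ring)
  rw [show x + t • (y - x) = (1 - t) • x + t • y + (0 : ℝ) • y by module, this]; ring

theorem convex_hull : Convex ℝ (hull Q) := convex_convexHull ℝ _

theorem isCompact_hull : IsCompact (hull Q) := (finite_range _).isCompact_convexHull ℝ

theorem isClosed_hull : IsClosed (hull Q) := (isCompact_hull Q).isClosed

theorem measurableSet_hull : MeasurableSet (hull Q) := (isClosed_hull Q).measurableSet

theorem points_mem_hull (i : Fin 3) : Q.points i ∈ hull Q := subset_convexHull ℝ _ (mem_range_self i)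

theorem interior_hull_nonempty : (interior (hull Q)).Nonempty :=
  ⟨_, (vertexBasis Q).centroid_mem_interior_convexHull⟩

theorem closure_interior_hull : closure (interior (hull Q)) = hull Q := by
  rw [(convex_hull Q).closure_interior_eq_closure_of_nonempty_interior (interior_hull_nonempty Q),
    (isClosed_hull Q).closure_eq]

theorem interior_ae_eq_of_convex {s : Set Plane} (hs : Convex ℝ s) :
    interior s =ᵐ[volume] s :=
  interior_ae_eq_of_null_frontier (hs.addHaar_frontier volume)

theorem interior_hull_ae_eq : interior (hull Q) =ᵐ[volume] hull Q :=
  interior_ae_eq_of_convex (convex_hull Q)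

/-- Twice the signed area of a triangle. -/
def orient : ℝ := cross (Q.points 1 - Q.points 0) (Q.points 2 - Q.points 0)

theorem cross_sub_sub_eq_orient (i : Fin 3) :
    cross (Q.points (i + 1) - Q.points i) (Q.points (i + 2) - Q.points i) = orient Q := by
  fin_cases i
  · rfl
  · simp only [orient, cross, Fin.mk_one, Fin.isValue, Fin.reduceAdd, PiLp.sub_apply]; ring
  · simp only [orient, cross, Fin.reduceFinMk, Fin.isValue, Fin.reduceAdd, PiLp.sub_apply]; ring

/-- By barycentric coordinates, a vector orthogonal to two sides is orthogonal to everything. If the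
determinant vanished, the quarter turn of one side would be such a vector, and two vertices would
coincide. -/
theorem orient_ne_zero : orient Q ≠ 0 := by
  intro h
  have key : ∀ z : Plane, ⟪z, Q.points 1 - Q.points 0⟫ = 0 → ⟪z, Q.points 2 - Q.points 0⟫ = 0 →
      z = 0 := by
    intro z h1 h2
    have h3 : ∀ x : Plane, ⟪z, x - Q.points 0⟫ = 0 := by
      intro x
      have hs := sum_bary Q x
      have hx := sum_bary_smul Q x
      rw [Fin.sum_univ_three] at hs hx
      have : x - Q.points 0 = bary Q 1 x • (Q.points 1 - Q.points 0) +
          bary Q 2 x • (Q.points 2 - Q.points 0) := by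
        nth_rw 1 [← hx]
        rw [show bary Q 0 x = 1 - bary Q 1 x - bary Q 2 x by linarith]
        module
      rw [this, inner_add_right, inner_smul_right, inner_smul_right, h1, h2]; simp
    have := h3 (z + Q.points 0)
    rwa [add_sub_cancel_right, inner_self_eq_zero] at this
  rw [orient] at h
  generalize hu : Q.points 1 - Q.points 0 = u at *
  generalize hv : Q.points 2 - Q.points 0 = v at *
  have h1 := key !₂[-u 1, u 0] (by simp [inner_plane]; ring)
    (by rw [cross] at h; simp [inner_plane]; linarith)
  have h10 : u 1 = 0 := by simpa using congrFun (congrArg WithLp.ofLp h1) 0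
  have h11 : u 0 = 0 := by simpa using congrFun (congrArg WithLp.ofLp h1) 1
  have hu0 : u = 0 := by ext k; fin_cases k <;> simpa
  rw [hu0, sub_eq_zero] at hu
  exact absurd (Q.independent.injective hu) (by decide)

/-! ### Integration over a triangle -/

section Integration

variable (Q : Affine.Triangle ℝ Plane)

/-- The point of parameter `t` on the segment from the vertex `i` to the point of parameter `s` of
the opposite edge. -/
def conePoint (i : Fin 3) (s t : ℝ) : Plane :=
  Q.points i + t • (edgePoint Q i s - Q.points i)

theorem conePoint_eq (i : Fin 3) (s t : ℝ) : conePoint Q i s t =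
    (1 - t) • Q.points i + (t * s) • Q.points (i + 1) + (t * (1 - s)) • Q.points (i + 2) := by
  rw [conePoint, edgePoint]; module

theorem bary_conePoint (i : Fin 3) (s t : ℝ) : bary Q i (conePoint Q i s t) = 1 - t ∧
    bary Q (i + 1) (conePoint Q i s t) = t * s ∧
    bary Q (i + 2) (conePoint Q i s t) = t * (1 - s) := by
  have h1 := add_one_ne i
  have h2 := add_two_ne i
  have h3 := add_one_ne_add_two i
  simp only [conePoint_eq, bary_combo Q _ (1 - t) (t * s) (t * (1 - s)) _ _ _ (by ring),
    bary_self, bary_of_ne Q h1, bary_of_ne Q h1.symm, bary_of_ne Q h2, bary_of_ne Q h2.symm,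
    bary_of_ne Q h3, bary_of_ne Q h3.symm]
  refine ⟨by ring, by ring, by ring⟩

/-- The open unit square in the plane. -/
def unitSquare : Set Plane := {y | y 0 ∈ Ioo (0 : ℝ) 1 ∧ y 1 ∈ Ioo (0 : ℝ) 1}

theorem measurableSet_unitSquare : MeasurableSet unitSquare := by
  apply MeasurableSet.inter
  · exact measurableSet_Ioo.preimage (by fun_prop)
  · exact measurableSet_Ioo.preimage (by fun_prop)

/-- A triangle is a cone over any of its edges: `t` measures the progress from the apex to the edge
and `s` the position on the edge. -/
theorem image_unitSquare (i : Fin 3) :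
    (fun y : Plane => conePoint Q i (y 0) (y 1)) '' unitSquare = interior (hull Q) := by
  ext x
  rw [mem_interior_hull_iff]
  constructor
  · rintro ⟨y, ⟨⟨h1, h2⟩, h3, h4⟩, rfl⟩ k
    obtain ⟨e1, e2, e3⟩ := bary_conePoint Q i (y 0) (y 1)
    dsimp only
    rcases eq_or_eq_or_eq i k with rfl | rfl | rfl
    · rw [e1]; linarith
    · rw [e2]; positivity
    · rw [e3]; exact mul_pos h3 (by linarith)
  · intro h
    have hs := sum_bary Q x
    have hx := sum_bary_smul Q x
    rw [sum_univ_rotate i] at hs hx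
    have h0 := h i
    have h1 := h (i + 1)
    have h2 := h (i + 2)
    have ht : 0 < 1 - bary Q i x := by linarith
    -- The inverse of the parametrization, read off `bary_conePoint`.
    refine ⟨!₂[bary Q (i + 1) x / (1 - bary Q i x), 1 - bary Q i x], ⟨⟨?_, ?_⟩, ?_, ?_⟩, ?_⟩
    · simpa using div_pos h1 ht
    · simpa using (div_lt_one ht).2 (by linarith)
    · simpa using ht
    · simpa using h0
    · refine Eq.trans ?_ hx
      simp only [conePoint_eq, Matrix.cons_val_zero, Matrix.cons_val_one, Matrix.cons_val_fin_one]
      rw [mul_sub, mul_div_cancel₀ _ ht.ne', mul_one, sub_sub_cancel,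
        show 1 - bary Q i x - bary Q (i + 1) x = bary Q (i + 2) x by linarith]

theorem injOn_conePoint (i : Fin 3) :
    InjOn (fun y : Plane => conePoint Q i (y 0) (y 1)) unitSquare := by
  rintro y ⟨-, hy, -⟩ z - h
  dsimp only at h
  obtain ⟨e1, e2, -⟩ := bary_conePoint Q i (y 0) (y 1)
  obtain ⟨e1', e2', -⟩ := bary_conePoint Q i (z 0) (z 1)
  rw [h, e1'] at e1
  rw [h, e2'] at e2
  have h1 : y 1 = z 1 := by linarith
  rw [← h1] at e2
  have h0 : y 0 = z 0 := (mul_left_cancel₀ hy.ne' e2).symm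
  ext k; fin_cases k <;> simpa

theorem hasFDerivAt_conePoint (i : Fin 3) (y : Plane) :
    HasFDerivAt (fun y : Plane => conePoint Q i (y 0) (y 1))
      ((EuclideanSpace.proj (0 : Fin 2) : Plane →L[ℝ] ℝ).smulRight
          (y 1 • (Q.points (i + 1) - Q.points (i + 2))) +
        (EuclideanSpace.proj (1 : Fin 2) : Plane →L[ℝ] ℝ).smulRight
          (edgePoint Q i (y 0) - Q.points i)) y := by
  have h0 : HasFDerivAt (fun y : Plane => y 0) (EuclideanSpace.proj (0 : Fin 2) : Plane →L[ℝ] ℝ) y :=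
    (EuclideanSpace.proj (0 : Fin 2) : Plane →L[ℝ] ℝ).hasFDerivAt
  have h1 : HasFDerivAt (fun y : Plane => y 1) (EuclideanSpace.proj (1 : Fin 2) : Plane →L[ℝ] ℝ) y :=
    (EuclideanSpace.proj (1 : Fin 2) : Plane →L[ℝ] ℝ).hasFDerivAt
  have hE : HasFDerivAt (fun y : Plane => edgePoint Q i (y 0) - Q.points i)
      ((EuclideanSpace.proj (0 : Fin 2) : Plane →L[ℝ] ℝ).smulRight
          (Q.points (i + 1) - Q.points (i + 2))) y := by
    have := ((h0.smul_const (Q.points (i + 1) - Q.points (i + 2))).add_const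
      (Q.points (i + 2) - Q.points i))
    refine this.congr_of_eventuallyEq (Filter.Eventually.of_forall fun z => ?_)
    simp only [edgePoint]; module
  have := (h1.smul hE).const_add (Q.points i)
  refine this.congr_fderiv ?_
  ext1 h
  simp [smul_smul, mul_comm]

theorem setIntegral_unitSquare (H : ℝ → ℝ → ℝ) (hH : Continuous (Function.uncurry H)) :
    ∫ y in unitSquare, H (y 0) (y 1) = ∫ s in (0 : ℝ)..1, ∫ t in (0 : ℝ)..1, H s t := by
  have hmp : MeasurePreserving (fun y : Plane => (y 0, y 1)) volume volume :=
    (volume_preserving_finTwoArrow ℝ).comp (PiLp.volume_preserving_ofLp (Fin 2))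
  have hemb : MeasurableEmbedding (fun y : Plane => (y 0, y 1)) :=
    MeasurableEquiv.measurableEmbedding
      ((MeasurableEquiv.toLp 2 (Fin 2 → ℝ)).symm.trans MeasurableEquiv.finTwoArrow)
  have h := hmp.setIntegral_preimage_emb hemb (fun z : ℝ × ℝ => H z.1 z.2) (Ioo 0 1 ×ˢ Ioo 0 1)
  have hpre : (fun y : Plane => (y 0, y 1)) ⁻¹' (Ioo (0 : ℝ) 1 ×ˢ Ioo (0 : ℝ) 1) = unitSquare := rfl
  rw [hpre] at h
  rw [h, Measure.volume_eq_prod, setIntegral_prod]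
  · simp only [intervalIntegral.integral_of_le zero_le_one, integral_Ioc_eq_integral_Ioo]
  · rw [← Measure.volume_eq_prod]
    refine IntegrableOn.mono_set (t := Icc 0 1 ×ˢ Icc 0 1) ?_
      (prod_mono Ioo_subset_Icc_self Ioo_subset_Icc_self)
    exact hH.continuousOn.integrableOn_compact (isCompact_Icc.prod isCompact_Icc)

theorem continuous_conePoint (i : Fin 3) : Continuous (Function.uncurry (conePoint Q i)) := by
  unfold Function.uncurry conePoint edgePoint; fun_prop

/-- Change of variables to cone coordinates. The partial derivative in `s` shrinks like `t` towards
the apex, which produces the weight `t`. -/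
theorem setIntegral_hull (i : Fin 3) (F : Plane → ℝ) (hF : Continuous F) :
    ∫ x in hull Q, F x =
      |orient Q| * ∫ s in (0 : ℝ)..1, ∫ t in (0 : ℝ)..1, t * F (conePoint Q i s t) := by
  rw [← setIntegral_congr_set (interior_hull_ae_eq Q), ← image_unitSquare Q i,
    integral_image_eq_integral_abs_det_fderiv_smul volume measurableSet_unitSquare
      (fun y _ => (hasFDerivAt_conePoint Q i y).hasFDerivWithinAt) (injOn_conePoint Q i)]
  rw [← setIntegral_unitSquare (fun s t => t * F (conePoint Q i s t)), ← integral_const_mul]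
  · refine setIntegral_congr_fun measurableSet_unitSquare fun y hy => ?_
    have hy1 : 0 < y 1 := hy.2.1
    dsimp only
    have : cross (y 1 • (Q.points (i + 1) - Q.points (i + 2))) (edgePoint Q i (y 0) - Q.points i)
        = y 1 * orient Q := by
      rw [← cross_sub_sub_eq_orient Q i]
      simp only [cross, edgePoint, PiLp.sub_apply, PiLp.add_apply, PiLp.smul_apply, smul_eq_mul]
      ring
    rw [det_smulRight_add_smulRight, this, abs_mul, abs_of_pos hy1, smul_eq_mul]
    ring
  · have := continuous_conePoint Q i
    exact continuous_snd.mul (hF.comp this)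

theorem volume_real_hull : volume.real (hull Q) = |orient Q| / 2 := by
  have h := setIntegral_hull Q 0 (fun _ => 1) continuous_const
  simp only [mul_one, integral_id, intervalIntegral.integral_const, smul_eq_mul] at h
  rw [setIntegral_const, smul_eq_mul, mul_one] at h
  rw [h]; ring

theorem volume_real_hull_pos : 0 < volume.real (hull Q) := by
  have := abs_pos.2 (orient_ne_zero Q)
  rw [volume_real_hull]; positivity

theorem inner_gradient (v : Plane → ℝ) (x w : Plane) :
    ⟪w, gradient v x⟫ = fderiv ℝ v x w := by
  rw [real_inner_comm, gradient, InnerProductSpace.toDual_symm_apply]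

/-- The Green formula for the field `x - W_i`. -/
theorem setIntegral_hull_inner_sub_gradient (i : Fin 3) (v : Plane → ℝ) (hv : ContDiff ℝ ∞ v) :
    (∫ x in hull Q, ⟪x - Q.points i, gradient v x⟫) + 2 * ∫ x in hull Q, v x =
      2 * volume.real (hull Q) * ∫ s in (0 : ℝ)..1, v (edgePoint Q i s) := by
  have hd : Continuous (fderiv ℝ v) := hv.continuous_fderiv (by simp)
  have hc : Continuous fun x => ⟪x - Q.points i, gradient v x⟫ := by
    simp only [inner_gradient v]
    exact hd.clm_apply (by fun_prop)
  have hc2 : Continuous fun x => ⟪x - Q.points i, gradient v x⟫ + 2 * v x :=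
    hc.add (continuous_const.mul hv.continuous)
  have hv2 : Continuous fun x => 2 * v x := continuous_const.mul hv.continuous
  rw [← integral_const_mul, ← integral_add
    (hc.continuousOn.integrableOn_compact (isCompact_hull Q))
    (hv2.continuousOn.integrableOn_compact (isCompact_hull Q)),
    setIntegral_hull Q i _ hc2, volume_real_hull, mul_div_cancel₀ _ two_ne_zero]
  congr 1
  refine intervalIntegral.integral_congr fun s _ => ?_
  -- On a ray from the apex, `x - W_i` is `t` times the velocity. Together with the weight `t`, the
  -- integrand becomes the exact derivative of `t² v`, and only the endpoint on the edge
  -- contributes.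
  have hder : ∀ t ∈ uIcc (0 : ℝ) 1, HasDerivAt (fun t => t ^ 2 * v (conePoint Q i s t))
      (t * (⟪conePoint Q i s t - Q.points i, gradient v (conePoint Q i s t)⟫ +
        2 * v (conePoint Q i s t))) t := by
    intro t _
    have h1 : HasDerivAt (fun t => conePoint Q i s t) (edgePoint Q i s - Q.points i) t := by
      have := ((hasDerivAt_id t).smul_const (edgePoint Q i s - Q.points i)).const_add (Q.points i)
      simpa [conePoint] using this
    have h2 := ((hv.differentiable (by simp)) (conePoint Q i s t)).hasFDerivAt.comp_hasDerivAt t h1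
    have h3 := (hasDerivAt_pow 2 t).mul h2
    refine h3.congr_deriv ?_
    have h4 : conePoint Q i s t - Q.points i = t • (edgePoint Q i s - Q.points i) :=
      add_sub_cancel_left _ _
    rw [inner_gradient v, h4, map_smul, smul_eq_mul]
    simp only [Function.comp]
    push_cast
    ring
  rw [intervalIntegral.integral_eq_sub_of_hasDerivAt hder]
  · simp [conePoint]
  · apply Continuous.intervalIntegrable
    have : Continuous fun t => conePoint Q i s t := by unfold conePoint; fun_prop
    exact continuous_id.mul (hc2.comp this)

end Integration

/-! ### Metric relations in a triangle -/

section Metric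

variable (Q : Affine.Triangle ℝ Plane)

theorem cot_angle_eq_div_orient (i : Fin 3) :
    Real.cot (EuclideanGeometry.angle (Q.points (i + 1)) (Q.points i) (Q.points (i + 2))) =
      ⟪Q.points (i + 1) - Q.points i, Q.points (i + 2) - Q.points i⟫ / |orient Q| := by
  rw [← cross_sub_sub_eq_orient Q i]
  exact cot_angle_eq _ _ ((cross_sub_sub_eq_orient Q i).trans_ne (orient_ne_zero Q))

theorem points_sub_ne_zero {i k : Fin 3} (h : i ≠ k) : Q.points i - Q.points k ≠ 0 :=
  sub_ne_zero.2 fun h' => h (Q.independent.injective h')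

theorem edgeLength_eq (i : Fin 3) : edgeLength Q i = ‖Q.points (i + 1) - Q.points (i + 2)‖ :=
  dist_eq_norm _ _

theorem edgeLength_pos (i : Fin 3) : 0 < edgeLength Q i := by
  rw [edgeLength_eq, norm_pos_iff]
  exact points_sub_ne_zero Q (add_one_ne_add_two i)

theorem cross_edge (i : Fin 3) :
    cross (Q.points (i + 1) - Q.points (i + 2)) (Q.points (i + 1) - Q.points i) = orient Q := by
  rw [← cross_sub_sub_eq_orient Q i]
  simp only [cross, PiLp.sub_apply]; ring

variable {Q} {i : Fin 3} {n : Plane}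

theorem edgeLength_mul_abs_inner (hn : ‖n‖ = 1)
    (ho : ⟪n, Q.points (i + 1) - Q.points (i + 2)⟫ = 0) :
    edgeLength Q i * |⟪n, Q.points (i + 1) - Q.points i⟫| = |orient Q| := by
  rw [edgeLength_eq, norm_mul_abs_inner_eq _ _ _ hn ho, cross_edge]

theorem inner_normal_ne_zero (hn : ‖n‖ = 1)
    (ho : ⟪n, Q.points (i + 1) - Q.points (i + 2)⟫ = 0) :
    ⟪n, Q.points (i + 1) - Q.points i⟫ ≠ 0 := by
  intro h
  have := edgeLength_mul_abs_inner hn ho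
  rw [h, abs_zero, mul_zero] at this
  exact orient_ne_zero Q (abs_eq_zero.1 this.symm)

/-- Both sides are affine functions vanishing on the edge, hence proportional; their values at the
vertex `i` fix the factor. -/
theorem inner_sub_eq_neg_mul_bary (ho : ⟪n, Q.points (i + 1) - Q.points (i + 2)⟫ = 0) (x : Plane) :
    ⟪n, x - Q.points (i + 1)⟫ = -⟪n, Q.points (i + 1) - Q.points i⟫ * bary Q i x := by
  have hs := sum_bary Q x
  have hx := sum_bary_smul Q x
  rw [sum_univ_rotate i] at hs hx
  have : x - Q.points (i + 1) = (-bary Q i x) • (Q.points (i + 1) - Q.points i) +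
      (-bary Q (i + 2) x) • (Q.points (i + 1) - Q.points (i + 2)) := by
    nth_rw 1 [← hx]
    rw [show bary Q (i + 1) x = 1 - bary Q i x - bary Q (i + 2) x by linarith]
    module
  rw [this, inner_add_right, inner_smul_right, inner_smul_right, ho]; ring

/-- This is the flux of the identity field through the edge. The length times the outward normal is
the edge vector turned by a right angle, in a direction given by the orientation of the triangle. -/
theorem edgeLength_mul_inner_normal (hn : ‖n‖ = 1)
    (ho : ⟪n, Q.points (i + 1) - Q.points (i + 2)⟫ = 0)
    (hout : 0 < ⟪n, Q.points (i + 1) - Q.points i⟫) :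
    edgeLength Q i * ⟪n, Q.points (i + 1)⟫ =
      |orient Q| / orient Q * cross (Q.points (i + 1)) (Q.points (i + 2)) := by
  have hD := orient_ne_zero Q
  have h1 := edgeLength_mul_abs_inner hn ho
  rw [abs_of_pos hout] at h1
  have hc := cross_edge Q i
  set e := Q.points (i + 1) - Q.points (i + 2) with he
  -- Again `e` is `cross n e` times the quarter turn of `n`.
  have key : ∀ w, cross n e * ⟪n, w⟫ = -cross e w := by
    intro w
    have h1 : n 0 * n 0 + n 1 * n 1 = 1 := by
      rw [← inner_plane, real_inner_self_eq_norm_sq, hn, one_pow]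
    rw [inner_plane] at ho
    rw [inner_plane, cross, cross]
    linear_combination (-(n 1 * w 0) + n 0 * w 1) * ho + (-(e 0 * w 1) + e 1 * w 0) * h1
  have h2 := key (Q.points (i + 1) - Q.points i)
  rw [hc] at h2
  have h3 := key (Q.points (i + 1))
  have h4 : cross e (Q.points (i + 1)) = cross (Q.points (i + 1)) (Q.points (i + 2)) := by
    simp only [he, cross, PiLp.sub_apply]; ring
  rw [h4] at h3
  set h := ⟪n, Q.points (i + 1) - Q.points i⟫
  rw [div_mul_eq_mul_div, eq_div_iff hD, ← h1]
  have : orient Q = -(cross n e * h) := by linarith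
  rw [this]
  linear_combination (-(edgeLength Q i * h)) * h3

theorem sum_cross_points :
    ∑ k : Fin 3, cross (Q.points (k + 1)) (Q.points (k + 2)) = orient Q := by
  rw [Fin.sum_univ_three]
  simp only [orient, cross, Fin.isValue, Fin.reduceAdd, PiLp.sub_apply]
  ring

variable (Q i) in
/-- The midpoint of the edge opposite to the vertex `i`. -/
def edgeMid : Plane := (2⁻¹ : ℝ) • (Q.points (i + 1) + Q.points (i + 2))

variable (Q i) in
theorem edgePoint_half : edgePoint Q i 2⁻¹ = edgeMid Q i := by
  rw [edgePoint, edgeMid]; module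

/-- Equal distances to the ends of the edge put the circumcenter on the normal line through the
midpoint; equal distance to the opposite vertex then fixes its position there. The formula is
signed, so it also holds without acuteness. -/
theorem circumcenter_eq (hn : ‖n‖ = 1)
    (ho : ⟪n, Q.points (i + 1) - Q.points (i + 2)⟫ = 0)
    (hout : 0 < ⟪n, Q.points (i + 1) - Q.points i⟫) :
    Q.circumcenter = edgeMid Q i - (edgeLength Q i * (Real.cot (EuclideanGeometry.angle
      (Q.points (i + 1)) (Q.points i) (Q.points (i + 2))) / 2)) • n := by
  have hl := edgeLength_mul_abs_inner hn ho
  rw [abs_of_pos hout] at hl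
  have hdist : ∀ k, ⟪Q.points k - Q.circumcenter, Q.points k - Q.circumcenter⟫ =
      Q.circumradius ^ 2 := fun k => by
    rw [real_inner_self_eq_norm_sq, ← dist_eq_norm, Affine.Simplex.dist_circumcenter_eq_circumradius]
  have hA := hdist (i + 1)
  have hB := hdist (i + 2)
  have hW := hdist i
  have hz : ⟪Q.circumcenter - edgeMid Q i, Q.points (i + 1) - Q.points (i + 2)⟫ = 0 := by
    have h := hA.trans hB.symm
    simp only [inner_plane, edgeMid, PiLp.sub_apply, PiLp.smul_apply, PiLp.add_apply,
      smul_eq_mul] at h ⊢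
    linear_combination -2⁻¹ * h
  have hn' := eq_inner_smul_of_inner_eq_zero n _ _ hn
    (points_sub_ne_zero Q (add_one_ne_add_two i)) ho hz
  set c := ⟪n, Q.circumcenter - edgeMid Q i⟫ with hc
  have hcirc : Q.circumcenter = edgeMid Q i + c • n := by rw [← hn']; abel
  -- Expanding the equality of the distances to the vertices `i` and `i + 1`: the terms in `c²`
  -- cancel.
  have hprod : 2 * (c * ⟪n, Q.points (i + 1) - Q.points i⟫) =
      -⟪Q.points (i + 1) - Q.points i, Q.points (i + 2) - Q.points i⟫ := by
    have h := hA.trans hW.symm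
    rw [hcirc] at h
    simp only [inner_plane, edgeMid, PiLp.sub_apply, PiLp.smul_apply, PiLp.add_apply,
      smul_eq_mul] at h ho ⊢
    linear_combination -h
  rw [hcirc, sub_eq_add_neg, ← neg_smul, cot_angle_eq_div_orient, ← hl]
  congr 2
  have := (edgeLength_pos Q i).ne'
  have := hout.ne'
  field_simp
  linear_combination hprod

-- Stewart's theorem for the segment joining a vertex to a point of the opposite edge.
variable (Q) in
theorem norm_edgePoint_sub_self_sq (i : Fin 3) (s : ℝ) : ‖edgePoint Q i s - Q.points i‖ ^ 2 =
    s * ‖Q.points (i + 1) - Q.points i‖ ^ 2 + (1 - s) * ‖Q.points (i + 2) - Q.points i‖ ^ 2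
      - (s - s ^ 2) * ‖Q.points (i + 1) - Q.points (i + 2)‖ ^ 2 := by
  simp only [← real_inner_self_eq_norm_sq, inner_plane, edgePoint, PiLp.sub_apply, PiLp.smul_apply,
    PiLp.add_apply, smul_eq_mul]
  ring

variable (Q) in
theorem norm_edgePoint_sub_add_one_sq (i : Fin 3) (s : ℝ) :
    ‖edgePoint Q i s - Q.points (i + 1)‖ ^ 2 =
      (1 - s) ^ 2 * ‖Q.points (i + 1) - Q.points (i + 2)‖ ^ 2 := by
  simp only [← real_inner_self_eq_norm_sq, inner_plane, edgePoint, PiLp.sub_apply, PiLp.smul_apply,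
    PiLp.add_apply, smul_eq_mul]
  ring

variable (Q) in
theorem norm_edgePoint_sub_add_two_sq (i : Fin 3) (s : ℝ) :
    ‖edgePoint Q i s - Q.points (i + 2)‖ ^ 2 =
      s ^ 2 * ‖Q.points (i + 1) - Q.points (i + 2)‖ ^ 2 := by
  simp only [← real_inner_self_eq_norm_sq, inner_plane, edgePoint, PiLp.sub_apply, PiLp.smul_apply,
    PiLp.add_apply, smul_eq_mul]
  ring

theorem integral_mul_comp_one_sub {g : ℝ → ℝ} (hsymm : ∀ s ∈ Ioo (0 : ℝ) 1, g s = g (1 - s))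
    (h : ℝ → ℝ) : ∫ s in (0 : ℝ)..1, g s * h (1 - s) = ∫ s in (0 : ℝ)..1, g s * h s := by
  have h1 : ∫ s in (0 : ℝ)..1, g s * h (1 - s) = ∫ s in (0 : ℝ)..1, g (1 - s) * h (1 - s) := by
    simp only [intervalIntegral.integral_of_le zero_le_one, integral_Ioc_eq_integral_Ioo]
    exact setIntegral_congr_fun measurableSet_Ioo fun s hs => by rw [← hsymm s hs]
  rw [h1, intervalIntegral.integral_comp_sub_left (fun s => g s * h s)]
  simp

/-- The three moments 1, 1/2, 0 of `g` are applied to a polynomial of degree two in `s`. From an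
endpoint of the edge the squared distance is a multiple of `s²` or `(1 - s)²`, which integrates to
zero. From the opposite vertex, Stewart's theorem leaves half of `a + b - c`, an inner product by
the law of cosines. -/
theorem integral_mul_norm_edgePoint_sub_sq {g : ℝ → ℝ} (hg : IntervalIntegrable g volume 0 1)
    (hg_one : ∫ s in (0 : ℝ)..1, g s = 1) (hg_sq : ∫ s in (0 : ℝ)..1, g s * s ^ 2 = 0)
    (hsymm : ∀ s ∈ Ioo (0 : ℝ) 1, g s = g (1 - s)) (i k : Fin 3) :
    ∫ s in (0 : ℝ)..1, g s * ‖edgePoint Q i s - Q.points k‖ ^ 2 =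
      if k = i then ⟪Q.points (i + 1) - Q.points i, Q.points (i + 2) - Q.points i⟫ else 0 := by
  have hint : ∀ h : ℝ → ℝ, Continuous h → IntervalIntegrable (fun s => g s * h s) volume 0 1 :=
    fun h hh => hg.mul_continuousOn hh.continuousOn
  have hint1 : IntervalIntegrable (fun s => g s * s) volume 0 1 := hint _ continuous_id
  have hint2 : IntervalIntegrable (fun s => g s * s ^ 2) volume 0 1 := hint _ (continuous_pow 2)
  have hhalf : ∫ s in (0 : ℝ)..1, g s * s = 1 / 2 := by
    have h1 := integral_mul_comp_one_sub hsymm fun s => s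
    have h2 : ∫ s in (0 : ℝ)..1, g s * (1 - s) =
        (∫ s in (0 : ℝ)..1, g s) - ∫ s in (0 : ℝ)..1, g s * s := by
      rw [← intervalIntegral.integral_sub hg hint1]
      exact intervalIntegral.integral_congr fun s _ => by ring
    rw [h2, hg_one] at h1
    linarith
  rcases eq_or_eq_or_eq i k with rfl | rfl | rfl
  · rw [if_pos rfl]
    set a := ‖Q.points (k + 1) - Q.points k‖ ^ 2 with ha
    set b := ‖Q.points (k + 2) - Q.points k‖ ^ 2 with hb
    set c := ‖Q.points (k + 1) - Q.points (k + 2)‖ ^ 2 with hc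
    have e : ∀ s, g s * ‖edgePoint Q k s - Q.points k‖ ^ 2 =
        b * g s + ((a - b - c) * (g s * s) + c * (g s * s ^ 2)) := fun s => by
      rw [norm_edgePoint_sub_self_sq]; ring
    simp only [e]
    rw [intervalIntegral.integral_add (hg.const_mul _)
      ((hint1.const_mul _).add (hint2.const_mul _)),
      intervalIntegral.integral_add (hint1.const_mul _)
      (hint2.const_mul _)]
    simp only [intervalIntegral.integral_const_mul]
    rw [hg_one, hg_sq, hhalf]
    simp only [ha, hb, hc, ← real_inner_self_eq_norm_sq, inner_plane, PiLp.sub_apply]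
    ring
  · rw [if_neg (add_one_ne i)]
    simp only [norm_edgePoint_sub_add_one_sq, ← mul_assoc]
    rw [intervalIntegral.integral_mul_const, integral_mul_comp_one_sub hsymm fun s => s ^ 2, hg_sq,
      zero_mul]
  · rw [if_neg (add_two_ne i)]
    simp only [norm_edgePoint_sub_add_two_sq, ← mul_assoc]
    rw [intervalIntegral.integral_mul_const, hg_sq, zero_mul]

end Metric

/-! ### Combinatorics of the mesh -/

theorem edgeMid_mem_hull (Q : Affine.Triangle ℝ Plane) (i : Fin 3) : edgeMid Q i ∈ hull Q := by
  rw [← edgePoint_half, edgePoint]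
  exact convex_hull _ (points_mem_hull _ _) (points_mem_hull _ _) (by norm_num) (by norm_num)
    (by norm_num)

theorem bary_edgeMid (Q : Affine.Triangle ℝ Plane) (i k : Fin 3) :
    bary Q k (edgeMid Q i) = if k = i then 0 else 2⁻¹ := by
  rw [edgeMid, show (2⁻¹ : ℝ) • (Q.points (i + 1) + Q.points (i + 2)) =
      (2⁻¹ : ℝ) • Q.points (i + 1) + (2⁻¹ : ℝ) • Q.points (i + 2) + (0 : ℝ) • Q.points i by module,
    bary_combo _ _ _ _ _ _ _ _ (by norm_num)]
  simp only [bary_points]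
  have h1 := add_one_ne i
  have h2 := add_two_ne i
  have h3 := add_one_ne_add_two i
  rcases eq_or_eq_or_eq i k with rfl | rfl | rfl
  · simp [h1.symm, h2.symm]
  · simp [h1, h3]
  · simp [h2, h3.symm]

/-- The affine functions that vanish on an edge are proportional. -/
theorem bary_eq_mul_of_vanish {Q R : Affine.Triangle ℝ Plane} {i j : Fin 3}
    (h1 : bary Q i (R.points (j + 1)) = 0) (h2 : bary Q i (R.points (j + 2)) = 0) (x : Plane) :
    bary Q i x = bary R j x * bary Q i (R.points j) := by
  have hx := sum_bary_smul R x
  have hs := sum_bary R x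
  rw [sum_univ_rotate j] at hx hs
  nth_rw 1 [← hx]
  rw [bary_combo _ _ _ _ _ _ _ _ hs, h1, h2]; ring

namespace TriMesh

variable {T : Type*} [Fintype T] {Ω : Set Plane} (M : TriMesh T Ω)

theorem W_injective (K : T) : Function.Injective (M.W K) := (M.tri K).independent.injective

theorem edge_eq_iff {K L : T} {i j : Fin 3} : M.edge K i = M.edge L j ↔
    (M.W K (i + 1) = M.W L (j + 1) ∧ M.W K (i + 2) = M.W L (j + 2)) ∨
      (M.W K (i + 1) = M.W L (j + 2) ∧ M.W K (i + 2) = M.W L (j + 1)) := by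
  have h : M.edge K i = M.edge L j ↔ s(M.W K (i + 1), M.W K (i + 2)) =
    s(M.W L (j + 1), M.W L (j + 2)) := Subtype.mk_eq_mk
  rw [h, Sym2.eq_iff]

theorem edge_injective (K : T) : Function.Injective (M.edge K) := by
  intro i j h
  simp only [edge_eq_iff, (M.W_injective K).eq_iff] at h
  revert i j; decide

theorem cell_subset_closure (K : T) : M.cell K ⊆ closure Ω := by
  rw [← M.cover]; exact subset_iUnion (fun K => hull (M.tri K)) K

theorem measurableSet_cell (K : T) : MeasurableSet (M.cell K) := measurableSet_hull _

theorem interior_closure_eq (hΩ : IsOpen Ω) (hc : Convex ℝ Ω) : interior (closure Ω) = Ω := by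
  rcases Ω.eq_empty_or_nonempty with h | h
  · simp [h]
  · rw [hc.interior_closure_eq_interior_of_nonempty_interior (by rwa [hΩ.interior_eq]),
      hΩ.interior_eq]

theorem interior_cell_subset (hΩ : IsOpen Ω) (hc : Convex ℝ Ω) (K : T) :
    interior (M.cell K) ⊆ Ω := by
  exact (interior_mono (M.cell_subset_closure K)).trans (interior_closure_eq hΩ hc).subset

/-- The coordinate vanishes at all vertices but one, and its zero set is convex. With `conformal`,
it vanishes on the intersection of two triangles as soon as that vertex is not shared. -/
theorem bary_eq_zero_of_mem_convexHull {Q : Affine.Triangle ℝ Plane} {i : Fin 3} {S : Set Plane}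
    (hS : S ⊆ range Q.points) (hi : Q.points i ∉ S) {x : Plane} (hx : x ∈ convexHull ℝ S) :
    bary Q i x = 0 := by
  have hconv : Convex ℝ (bary Q i ⁻¹' {0}) := (convex_singleton 0).affine_preimage _
  refine convexHull_min ?_ hconv hx
  intro y hy
  obtain ⟨k, rfl⟩ := hS hy
  exact bary_of_ne Q fun h => hi (h ▸ hy)

/-- Two sets of three vertices, one contained in the other, would be equal. -/
theorem exists_W_notMem {K L : T} (h : K ≠ L) : ∃ i, M.W K i ∉ range (M.tri L).points := by
  by_contra! hall
  apply h
  apply M.vertices_injective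
  dsimp only
  have hsub : range (M.tri K).points ⊆ range (M.tri L).points := by
    rintro _ ⟨i, rfl⟩; exact hall i
  refine eq_of_subset_of_ncard_le hsub ?_ (finite_range _)
  rw [← image_univ, ← image_univ, ncard_image_of_injective _ (M.tri K).independent.injective,
    ncard_image_of_injective _ (M.tri L).independent.injective]

theorem interior_cell_inter_cell {K L : T} (h : K ≠ L) : interior (M.cell K) ∩ M.cell L = ∅ := by
  obtain ⟨i, hi⟩ := M.exists_W_notMem h
  rw [eq_empty_iff_forall_notMem]
  rintro x ⟨hxK, hxL⟩
  have hx : x ∈ hull (M.tri K) ∩ hull (M.tri L) := ⟨interior_subset hxK, hxL⟩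
  rw [M.conformal K L h] at hx
  have h0 := bary_eq_zero_of_mem_convexHull inter_subset_left (fun h' => hi h'.2) hx
  exact ((mem_interior_hull_iff _).1 hxK i).ne' h0

theorem volume_cell_inter_cell {K L : T} (h : K ≠ L) : volume (M.cell K ∩ M.cell L) = 0 := by
  refine measure_mono_null ?_ ((convex_hull (M.tri K)).addHaar_frontier volume)
  rintro x ⟨hxK, hxL⟩
  rw [(isClosed_hull _).frontier_eq]
  refine ⟨hxK, fun hx => ?_⟩
  have : x ∈ interior (M.cell K) ∩ M.cell L := ⟨hx, hxL⟩
  rw [M.interior_cell_inter_cell h] at this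
  exact this

theorem edgeMid_eq_of_edge_eq {K L : T} {i j : Fin 3} (he : M.edge K i = M.edge L j) :
    edgeMid (M.tri K) i = edgeMid (M.tri L) j := by
  rw [edgeMid, edgeMid]
  rcases M.edge_eq_iff.1 he with ⟨h1, h2⟩ | ⟨h1, h2⟩
  · simp only [W] at h1 h2; rw [h1, h2]
  · simp only [W] at h1 h2; rw [h1, h2, add_comm]

theorem bary_eq_zero_of_edge_eq {K L : T} {i j : Fin 3} (he : M.edge K i = M.edge L j) :
    bary (M.tri K) i (M.W L (j + 1)) = 0 ∧ bary (M.tri K) i (M.W L (j + 2)) = 0 := by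
  have h1 : bary (M.tri K) i (M.W K (i + 1)) = 0 := bary_of_ne _ (add_one_ne i).symm
  have h2 : bary (M.tri K) i (M.W K (i + 2)) = 0 := bary_of_ne _ (add_two_ne i).symm
  rcases M.edge_eq_iff.1 he with h | h
  · rw [← h.1, ← h.2]; exact ⟨h1, h2⟩
  · rw [← h.1, ← h.2]; exact ⟨h2, h1⟩

/-- Two triangles lie on opposite sides of a common edge. -/
theorem bary_W_neg {K L : T} {i j : Fin 3} (h : K ≠ L) (he : M.edge K i = M.edge L j) :
    bary (M.tri K) i (M.W L j) < 0 := by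
  obtain ⟨hz1, hz2⟩ := M.bary_eq_zero_of_edge_eq he
  -- Some vertex of `K` is not a vertex of `L`; since the ends of the edge are shared, it is the one
  -- opposite to the edge.
  have hni : M.W K i ∉ range (M.tri L).points := by
    obtain ⟨k, hk⟩ := M.exists_W_notMem h
    rcases eq_or_eq_or_eq i k with rfl | rfl | rfl
    · exact hk
    · exfalso; apply hk
      rcases M.edge_eq_iff.1 he with h | h
      · exact ⟨_, h.1.symm⟩
      · exact ⟨_, h.1.symm⟩
    · exfalso; apply hk
      rcases M.edge_eq_iff.1 he with h | h
      · exact ⟨_, h.2.symm⟩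
      · exact ⟨_, h.2.symm⟩
  have hle : ∀ x ∈ M.cell K ∩ M.cell L, bary (M.tri K) i x = 0 := by
    intro x hx
    have hx' : x ∈ hull (M.tri K) ∩ hull (M.tri L) := hx
    rw [M.conformal K L h] at hx'
    exact bary_eq_zero_of_mem_convexHull inter_subset_left (fun h' => hni h'.2) hx'
  by_contra! hV
  -- A zero value would make this coordinate vanish at all vertices of `L`, hence everywhere. A
  -- positive one would give `K ∩ L` points off the line of the edge.
  rcases hV.eq_or_lt with hV | hV
  · have hall : ∀ x, bary (M.tri K) i x = 0 := by
      intro x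
      rw [bary_eq_mul_of_vanish hz1 hz2, show bary (M.tri K) i ((M.tri L).points j) = 0 from hV.symm,
        mul_zero]
    have := hall (M.W K i)
    rw [W, bary_self] at this
    exact one_ne_zero this
  · -- a point of `L` near the midpoint of the edge belongs to `K`
    set m := edgeMid (M.tri L) j with hm
    have hmb : ∀ k, bary (M.tri K) k m = if k = i then 0 else 2⁻¹ := by
      intro k
      rw [hm, ← M.edgeMid_eq_of_edge_eq he, bary_edgeMid]
    have hev : ∀ᶠ t in nhdsWithin (0 : ℝ) (Ioi 0), (∀ k, k ≠ i →
        0 < bary (M.tri K) k (m + t • (M.W L j - m))) := by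
      rw [Filter.eventually_all]
      intro k
      by_cases hk : k = i
      · simp [hk]
      · have hcont : Continuous fun t : ℝ => bary (M.tri K) k (m + t • (M.W L j - m)) :=
          (continuous_bary _ k).comp (by fun_prop)
        have := hcont.tendsto 0
        have hpos : 0 < bary (M.tri K) k (m + (0 : ℝ) • (M.W L j - m)) := by
          rw [zero_smul, add_zero, hmb, if_neg hk]; norm_num
        filter_upwards [nhdsWithin_le_nhds (this.eventually (lt_mem_nhds hpos))] with t ht _ using ht
    have hev1 : ∀ᶠ t in nhdsWithin (0 : ℝ) (Ioi 0), t < 1 :=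
      nhdsWithin_le_nhds (gt_mem_nhds one_pos)
    obtain ⟨t, ⟨ht, ht1⟩, ht0⟩ := ((hev.and hev1).and self_mem_nhdsWithin).exists
    have ht0 : 0 < t := ht0
    have hbi : bary (M.tri K) i (m + t • (M.W L j - m)) = t * bary (M.tri K) i (M.W L j) := by
      rw [bary_add_smul_sub, hmb, if_pos rfl]; ring
    have hmL : m ∈ hull (M.tri L) := edgeMid_mem_hull _ _
    have hy : m + t • (M.W L j - m) ∈ M.cell K ∩ M.cell L := by
      constructor
      · refine (mem_hull_iff _).2 fun k => ?_
        by_cases hk : k = i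
        · rw [hk, hbi]; positivity
        · exact (ht k hk).le
      · exact (convex_hull _).add_smul_sub_mem hmL (points_mem_hull _ _) ⟨ht0.le, ht1.le⟩
    have := hle _ hy
    rw [hbi] at this
    exact (mul_pos ht0 hV).ne' this

end TriMesh

/-! ### Internal and boundary edges -/

namespace TriMesh

variable {T : Type*} [Fintype T] {Ω : Set Plane} (M : TriMesh T Ω)

theorem seg_edge (K : T) (i : Fin 3) : M.seg (M.edge K i) = segment ℝ (M.W K (i + 1)) (M.W K (i + 2)) := by
  rw [← convexHull_pair]
  unfold seg
  congr 1
  ext x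
  exact Sym2.mem_iff

theorem edgePoint_mem_seg (K : T) (i : Fin 3) {s : ℝ} (h0 : 0 ≤ s) (h1 : s ≤ 1) :
    edgePoint (M.tri K) i s ∈ M.seg (M.edge K i) := by
  rw [seg_edge]
  exact ⟨s, 1 - s, h0, by linarith, by ring, rfl⟩

theorem edgeMid_mem_seg (K : T) (i : Fin 3) : edgeMid (M.tri K) i ∈ M.seg (M.edge K i) := by
  rw [← edgePoint_half]
  exact M.edgePoint_mem_seg K i (by norm_num) (by norm_num)

/-- A point of the edge off the frontier could be an endpoint; since `Ω` is open, it can be moved to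
the relative interior of the edge, as needed to locate the neighbor. -/
theorem exists_mem_of_not_isBoundary (hΩ : IsOpen Ω) {K : T} {i : Fin 3}
    (h : ¬ M.IsBoundary (M.edge K i)) :
    ∃ s ∈ Ioo (0 : ℝ) 1, edgePoint (M.tri K) i s ∈ Ω := by
  rw [IsBoundary, not_subset] at h
  obtain ⟨x, hx, hxf⟩ := h
  rw [seg_edge] at hx
  obtain ⟨s, s', h0, h0', hs, rfl⟩ := hx
  have hs' : s' = 1 - s := by linarith
  subst hs'
  have hcell : edgePoint (M.tri K) i s ∈ closure Ω := M.cell_subset_closure K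
    ((convex_hull _) (points_mem_hull _ _) (points_mem_hull _ _) h0 h0' hs)
  have hxΩ : edgePoint (M.tri K) i s ∈ Ω := by
    by_contra hn
    exact hxf (by rw [hΩ.frontier_eq]; exact ⟨hcell, hn⟩)
  have hcont : Continuous (edgePoint (M.tri K) i) := by unfold edgePoint; fun_prop
  have hopen := hΩ.preimage hcont
  have hcl : s ∈ closure (Ioo (0 : ℝ) 1) := by
    rw [closure_Ioo zero_ne_one]; exact ⟨h0, by linarith⟩
  obtain ⟨t, ht, ht'⟩ := mem_closure_iff.1 hcl _ hopen hxΩ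
  exact ⟨t, ht', ht⟩

/-- An internal edge belongs to a second triangle. -/
theorem exists_neighbor (hΩ : IsOpen Ω) {K : T} {i : Fin 3} (h : ¬ M.IsBoundary (M.edge K i)) :
    ∃ L j, K ≠ L ∧ M.edge K i = M.edge L j := by
  obtain ⟨s, ⟨hs0, hs1⟩, hsΩ⟩ := M.exists_mem_of_not_isBoundary hΩ h
  set x := edgePoint (M.tri K) i s with hx
  have hb : ∀ k, bary (M.tri K) k x = if k = i then 0 else if k = i + 1 then s else 1 - s := by
    intro k
    obtain ⟨h0, h1, h2⟩ := bary_conePoint (M.tri K) i s 1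
    have : conePoint (M.tri K) i s 1 = x := by rw [conePoint, one_smul, add_sub_cancel]
    rw [this] at h0 h1 h2
    rcases eq_or_eq_or_eq i k with rfl | rfl | rfl
    · simpa using h0
    · simpa [add_one_ne] using h1
    · simpa [add_two_ne, (add_one_ne_add_two i).symm] using h2
  set C := ⋃ L ∈ {L : T | L ≠ K}, M.cell L with hC
  have hCclosed : IsClosed C := (toFinite _).isClosed_biUnion fun L _ => isClosed_hull _
  have hxC : x ∈ C := by
    by_contra hxC
    have hcont : Continuous fun t : ℝ => x + t • (M.W K i - x) := by fun_prop
    -- Negative `t` moves away from the opposite vertex, out of `K` through the edge. Such a point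
    -- stays in `Ω`, so another triangle must cover it.
    have h1 : ∀ᶠ t in nhdsWithin (0 : ℝ) (Iio 0), x + t • (M.W K i - x) ∈ Ω ∩ Cᶜ := by
      refine nhdsWithin_le_nhds ((hΩ.inter hCclosed.isOpen_compl).preimage hcont |>.mem_nhds ?_)
      simpa using ⟨hsΩ, hxC⟩
    obtain ⟨t, ⟨htΩ, htC⟩, ht0⟩ := (h1.and self_mem_nhdsWithin).exists
    have ht0 : t < 0 := ht0
    have hmem : x + t • (M.W K i - x) ∈ ⋃ K, hull (M.tri K) := by
      rw [M.cover]; exact subset_closure htΩ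
    obtain ⟨L, hL⟩ := mem_iUnion.1 hmem
    by_cases hLK : L = K
    · rw [hLK, mem_hull_iff] at hL
      have := hL i
      rw [bary_add_smul_sub, hb, if_pos rfl, W, bary_self] at this
      linarith
    · exact htC (mem_biUnion hLK hL)
  obtain ⟨L, hLK, hxL⟩ := mem_iUnion₂.1 hxC
  have hKL : K ≠ L := fun h => hLK h.symm
  have hxK : x ∈ M.cell K := by
    refine (mem_hull_iff _).2 fun k => ?_
    rw [hb]; split_ifs <;> linarith
  have hxx : x ∈ hull (M.tri K) ∩ hull (M.tri L) := ⟨hxK, hxL⟩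
  rw [M.conformal K L hKL] at hxx
  -- As `x` is strictly between the ends of the edge, both of its coordinates there are positive, so
  -- both ends must be vertices of `L`.
  have hin : ∀ k, k ≠ i → M.W K k ∈ range (M.tri L).points := by
    intro k hk
    by_contra hn
    have h0 := bary_eq_zero_of_mem_convexHull inter_subset_left (fun h' => hn h'.2) hxx
    rw [hb, if_neg hk] at h0
    split_ifs at h0 <;> linarith
  obtain ⟨p, hp⟩ := hin _ (add_one_ne i)
  obtain ⟨q, hq⟩ := hin _ (add_two_ne i)
  have hpq : p ≠ q := by
    rintro rfl
    exact add_one_ne_add_two i (M.W_injective K (hp.symm.trans hq))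
  have : ∀ p q : Fin 3, p ≠ q → ∃ j, (p = j + 1 ∧ q = j + 2) ∨ (p = j + 2 ∧ q = j + 1) := by decide
  obtain ⟨j, hj⟩ := this p q hpq
  refine ⟨L, j, hKL, M.edge_eq_iff.2 ?_⟩
  rcases hj with ⟨rfl, rfl⟩ | ⟨rfl, rfl⟩
  · exact Or.inl ⟨hp.symm, hq.symm⟩
  · exact Or.inr ⟨hp.symm, hq.symm⟩

/-- A boundary edge belongs to one triangle only. -/
theorem eq_of_isBoundary (hΩ : IsOpen Ω) (hc : Convex ℝ Ω) {K L : T} {i j : Fin 3}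
    (h : M.IsBoundary (M.edge K i)) (he : M.edge K i = M.edge L j) : K = L := by
  by_contra hKL
  have hneg := M.bary_W_neg hKL he
  obtain ⟨hz1, hz2⟩ := M.bary_eq_zero_of_edge_eq he
  set m := edgeMid (M.tri K) i with hm
  have hpos : ∀ (R : Affine.Triangle ℝ Plane) (l : Fin 3), m = edgeMid R l →
      ∀ᶠ y in nhds m, ∀ k, k ≠ l → 0 < bary R k y := by
    intro R l hR
    rw [Filter.eventually_all]
    intro k
    by_cases hk : k = l
    · simp [hk]
    · have h0 : 0 < bary R k m := by rw [hR, bary_edgeMid, if_neg hk]; norm_num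
      filter_upwards [(continuous_bary R k).tendsto m |>.eventually (lt_mem_nhds h0)] with y hy _
        using hy
  -- Two triangles on opposite sides of the edge fill a neighborhood of its midpoint, which puts the
  -- midpoint in the interior of the closure; that interior is `Ω`, since `Ω` is convex and open.
  have hev : ∀ᶠ y in nhds m, y ∈ closure Ω := by
    filter_upwards [hpos (M.tri K) i rfl, hpos (M.tri L) j (M.edgeMid_eq_of_edge_eq he)]
      with y hyK hyL
    -- The coordinates of the two triangles at the common edge have opposite signs, so this sign
    -- decides which triangle contains `y`.
    rcases le_or_gt 0 (bary (M.tri K) i y) with hy | hy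
    · refine M.cell_subset_closure K ((mem_hull_iff _).2 fun k => ?_)
      by_cases hk : k = i
      · rwa [hk]
      · exact (hyK k hk).le
    · refine M.cell_subset_closure L ((mem_hull_iff _).2 fun k => ?_)
      by_cases hk : k = j
      · rw [hk]
        rw [bary_eq_mul_of_vanish hz1 hz2] at hy
        by_contra! hlt
        exact absurd hy (not_lt.2 (mul_pos_of_neg_of_neg hlt hneg).le)
      · exact (hyL k hk).le
  have hmint : m ∈ interior (closure Ω) := mem_interior_iff_mem_nhds.2 hev
  rw [interior_closure_eq hΩ hc] at hmint
  have hmf : m ∈ frontier Ω := h (M.edgeMid_mem_seg K i)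
  rw [hΩ.frontier_eq] at hmf
  exact hmf.2 hmint

end TriMesh

namespace EdgeNormals

variable {T : Type*} [Fintype T] {Ω : Set Plane} {M : TriMesh T Ω} (N : EdgeNormals M)

theorem inner_ne_zero (K : T) (i : Fin 3) :
    ⟪N.n (M.edge K i), M.W K (i + 1) - M.W K i⟫ ≠ 0 :=
  inner_normal_ne_zero (N.norm_n _) (N.orthogonal K i)

theorem ε_mul_self (K : T) (i : Fin 3) : N.ε K i * N.ε K i = 1 := by
  unfold ε; split_ifs <;> norm_num

theorem ε_ne_zero (K : T) (i : Fin 3) : N.ε K i ≠ 0 := by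
  unfold ε; split_ifs <;> norm_num

theorem ε_of_isBoundary {K : T} {i : Fin 3} (h : M.IsBoundary (M.edge K i)) : N.ε K i = 1 := by
  rw [ε, if_pos]; exact N.boundary K i h

theorem inner_ε_smul_pos (K : T) (i : Fin 3) :
    0 < ⟪N.ε K i • N.n (M.edge K i), M.W K (i + 1) - M.W K i⟫ := by
  rw [inner_smul_left]
  have h := N.inner_ne_zero K i
  unfold ε PointsOut
  split_ifs with h1
  · simpa using h1
  · simpa using lt_of_le_of_ne (not_lt.1 h1) h

theorem norm_ε_smul (K : T) (i : Fin 3) : ‖N.ε K i • N.n (M.edge K i)‖ = 1 := by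
  rw [norm_smul, N.norm_n, mul_one]
  unfold ε; split_ifs <;> simp

theorem inner_ε_smul_edge (K : T) (i : Fin 3) :
    ⟪N.ε K i • N.n (M.edge K i), M.W K (i + 1) - M.W K (i + 2)⟫ = 0 := by
  rw [inner_smul_left, N.orthogonal, mul_zero]

theorem inner_W_eq_of_edge_eq {K L : T} {i j : Fin 3} (he : M.edge K i = M.edge L j) :
    ⟪N.n (M.edge K i), M.W K (i + 1)⟫ = ⟪N.n (M.edge L j), M.W L (j + 1)⟫ := by
  have h := N.orthogonal K i
  rw [inner_sub_right, sub_eq_zero] at h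
  rw [← he]
  rcases M.edge_eq_iff.1 he with h1 | h1
  · rw [h1.1]
  · rw [← h1.2, h]

/-- The chosen normal of a common edge points outwards exactly one of the two triangles. -/
theorem pointsOut_iff_not {K L : T} {i j : Fin 3} (hKL : K ≠ L) (he : M.edge K i = M.edge L j) :
    N.PointsOut K i ↔ ¬ N.PointsOut L j := by
  have hneg := M.bary_W_neg hKL he
  have h1 := inner_sub_eq_neg_mul_bary (N.orthogonal K i) (M.W L j)
  have h2 := N.inner_W_eq_of_edge_eq he
  have hK := N.inner_ne_zero K i
  unfold PointsOut
  -- The same normal measures the heights of both opposite vertices over the edge; their ratio is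
  -- the negative coordinate of `W_{L,j}`.
  have h3 : ⟪N.n (M.edge L j), M.W L (j + 1) - M.W L j⟫ =
      ⟪N.n (M.edge K i), M.W K (i + 1) - M.W K i⟫ * bary (M.tri K) i (M.W L j) := by
    rw [inner_sub_right, ← h2, ← he]
    simp only [TriMesh.W] at h1 ⊢
    rw [inner_sub_right] at h1
    linarith
  rw [h3, not_lt]
  constructor
  · intro h; exact (mul_neg_of_pos_of_neg h hneg).le
  · intro h
    by_contra! hle
    exact absurd (mul_pos_of_neg_of_neg (lt_of_le_of_ne hle hK) hneg) (not_lt.2 h)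

theorem ε_eq_neg {K L : T} {i j : Fin 3} (hKL : K ≠ L) (he : M.edge K i = M.edge L j) :
    N.ε L j = -N.ε K i := by
  have := N.pointsOut_iff_not hKL he
  unfold ε
  by_cases h : N.PointsOut L j
  · rw [if_pos h, if_neg (fun h' => this.1 h' h)]; norm_num
  · rw [if_neg h, if_pos (this.2 h)]

theorem ne_of_isInnerCoboundary {a : M.Edge} {K L : T} {i j : Fin 3}
    (h : N.IsInnerCoboundary a K i L j) : K ≠ L := by
  rintro rfl
  obtain ⟨-, h1, h2, h3, h4⟩ := h
  obtain rfl := M.edge_injective K (h1.trans h2.symm)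
  exact h4 h3

theorem isBoundary_or_isInnerCoboundary (hΩ : IsOpen Ω) (a : M.Edge) :
    (M.IsBoundary a ∧ ∃ K i, M.edge K i = a) ∨ ∃ K i L j, N.IsInnerCoboundary a K i L j := by
  obtain ⟨⟨K, i⟩, hK⟩ := M.edge_surjective a
  dsimp only at hK
  by_cases h : M.IsBoundary a
  · exact Or.inl ⟨h, K, i, hK⟩
  · right
    subst hK
    obtain ⟨L, j, hKL, he⟩ := M.exists_neighbor hΩ h
    have hiff := N.pointsOut_iff_not hKL he
    by_cases ho : N.PointsOut K i
    · exact ⟨K, i, L, j, h, rfl, he.symm, ho, hiff.1 ho⟩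
    · exact ⟨L, j, K, i, h, he.symm, rfl, not_not.1 (fun h' => ho (hiff.2 h')), ho⟩

open Classical in
theorem sum_edge_of_isBoundary (hΩ : IsOpen Ω) (hc : Convex ℝ Ω) {A : Type*} [AddCommMonoid A]
    (f : T → Fin 3 → A) {K : T} {i : Fin 3} (h : M.IsBoundary (M.edge K i)) :
    ∑ L, ∑ j, (if M.edge L j = M.edge K i then f L j else 0) = f K i := by
  rw [Finset.sum_eq_single K, Finset.sum_eq_single i]
  · simp
  · intro j _ hj
    rw [if_neg fun h' => hj (M.edge_injective K h')]
  · simp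
  · intro L _ hL
    exact Finset.sum_eq_zero fun j _ => if_neg fun h' =>
      hL (M.eq_of_isBoundary hΩ hc h h'.symm).symm
  · simp

open Classical in
theorem sum_edge_of_ne {A : Type*} [AddCommMonoid A] (f : T → Fin 3 → A) {K L : T} {i j : Fin 3}
    (hKL : K ≠ L) (he : M.edge K i = M.edge L j) (N : EdgeNormals M) :
    ∑ R, ∑ k, (if M.edge R k = M.edge K i then f R k else 0) = f K i + f L j := by
  rw [Finset.sum_eq_add K L hKL]
  · congr 1
    · rw [Finset.sum_eq_single i]
      · simp
      · intro j _ hj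
        rw [if_neg fun h' => hj (M.edge_injective K h')]
      · simp
    · rw [he, Finset.sum_eq_single j]
      · simp
      · intro j _ hj
        rw [if_neg fun h' => hj (M.edge_injective L h')]
      · simp
  · rintro R - ⟨hRK, hRL⟩
    -- A third triangle on the edge is impossible: three signs cannot be pairwise opposite.
    refine Finset.sum_eq_zero fun k _ => if_neg fun h' => ?_
    have h1 := N.ε_eq_neg hKL he
    have h2 := N.ε_eq_neg hRK h'
    have h3 := N.ε_eq_neg hRL (h'.trans he)
    have h4 := N.ε_ne_zero R k
    rw [h2, h3] at h1
    apply h4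
    linarith
  · simp
  · simp

end EdgeNormals

/-! ### Square-integrable fields and weak divergences -/

section Lebesgue

theorem memLp_restrict_of_continuous {F : Type*} [NormedAddCommGroup F] {S : Set Plane} (hS : MeasurableSet S)
    (hb : Bornology.IsBounded S) {f : Plane → F} (hf : Continuous f) :
    MemLp f 2 (volume.restrict S) := by
  have hcpt : IsCompact (closure S) := hb.isCompact_closure
  have : IsFiniteMeasure (volume.restrict S) :=
    ⟨by rw [Measure.restrict_apply_univ]; exact hb.measure_lt_top⟩
  obtain ⟨C, hC⟩ := hcpt.exists_bound_of_continuousOn hf.continuousOn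
  refine MemLp.of_bound ?_ C ?_
  · exact hf.continuousOn.aestronglyMeasurable_of_subset_isCompact hcpt hS subset_closure
  · filter_upwards [ae_restrict_mem hS] with x hx using hC x (subset_closure hx)

variable {F : Type*} [NormedAddCommGroup F] [InnerProductSpace ℝ F]

theorem integrable_inner_of_memLp {α : Type*} {mα : MeasurableSpace α} {μ : Measure α}
    {p q : α → F} (hp : MemLp p 2 μ) (hq : MemLp q 2 μ) : Integrable (fun x => ⟪p x, q x⟫) μ := by
  refine (L2.integrable_inner (𝕜 := ℝ) (hp.toLp p) (hq.toLp q)).congr ?_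
  filter_upwards [hp.coeFn_toLp, hq.coeFn_toLp] with x h1 h2
  rw [h1, h2]

theorem integrable_mul_of_memLp {α : Type*} {mα : MeasurableSpace α} {μ : Measure α}
    {p q : α → ℝ} (hp : MemLp p 2 μ) (hq : MemLp q 2 μ) : Integrable (fun x => p x * q x) μ := by
  refine (integrable_inner_of_memLp hp hq).congr (Filter.Eventually.of_forall fun x => ?_)
  simp [mul_comm]

theorem continuous_gradient {v : Plane → ℝ} (hv : ContDiff ℝ ∞ v) : Continuous (gradient v) := by
  unfold gradient
  exact (LinearIsometryEquiv.continuous _).comp (hv.continuous_fderiv (by simp))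

/-- Fundamental lemma of the calculus of variations, applied to the difference of the two
divergences. -/
theorem IsWeakDiv.ae_eq {U : Set Plane} (hU : IsOpen U) (hb : Bornology.IsBounded U)
    {p : Plane → Plane} {d d' : Plane → ℝ} (hd : MemLp d 2 (volume.restrict U))
    (hd' : MemLp d' 2 (volume.restrict U)) (h : IsWeakDiv U p d) (h' : IsWeakDiv U p d') :
    d =ᵐ[volume.restrict U] d' := by
  have : IsFiniteMeasure (volume.restrict U) :=
    ⟨by rw [Measure.restrict_apply_univ]; exact hb.measure_lt_top⟩
  have hi : IntegrableOn (d - d') U volume := (hd.sub hd').integrable one_le_two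
  have key := hU.ae_eq_zero_of_integral_contDiff_smul_eq_zero (μ := volume)
    hi.locallyIntegrableOn fun v hv hvc hvs => by
      have hvm := memLp_restrict_of_continuous hU.measurableSet hb hv.continuous
      have h1 := h v hv hvc hvs
      rw [h' v hv hvc hvs, neg_inj] at h1
      rw [← setIntegral_eq_integral_of_forall_compl_eq_zero (s := U)]
      · have : ∀ x, v x • (d - d') x = d x * v x - d' x * v x := fun x => by
          simp only [Pi.sub_apply, smul_eq_mul]; ring
        simp only [this]
        rw [integral_sub (integrable_mul_of_memLp hd hvm) (integrable_mul_of_memLp hd' hvm), h1,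
          sub_self]
      · intro x hx
        rw [image_eq_zero_of_notMem_tsupport fun hx' => hx (hvs hx'), zero_smul]
  rw [Filter.EventuallyEq, ae_restrict_iff' hU.measurableSet]
  filter_upwards [key] with x hx hxU
  exact sub_eq_zero.1 (hx hxU)

theorem div_ae_eq {U : Set Plane} (hU : IsOpen U) (hb : Bornology.IsBounded U) {p : Plane → Plane}
    {d : Plane → ℝ} (hd : MemLp d 2 (volume.restrict U)) (h : IsWeakDiv U p d) :
    div U p =ᵐ[volume.restrict U] d := by
  have hex : ∃ d : Plane → ℝ, MemLp d 2 (volume.restrict U) ∧ IsWeakDiv U p d := ⟨d, hd, h⟩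
  rw [div, dif_pos hex]
  exact IsWeakDiv.ae_eq hU hb hex.choose_spec.1 hd hex.choose_spec.2 h

theorem l2_comm (Ω : Set Plane) (p q : Plane → F) : l2 Ω p q = l2 Ω q p := by
  simp only [l2, real_inner_comm]

theorem l2_sum_left {ι : Type*} (s : Finset ι) {Ω : Set Plane} {p : ι → Plane → F}
    {q : Plane → F} (hp : ∀ k ∈ s, MemLp (p k) 2 (volume.restrict Ω))
    (hq : MemLp q 2 (volume.restrict Ω)) (c : ι → ℝ) :
    l2 Ω (∑ k ∈ s, c k • p k) q = ∑ k ∈ s, c k * l2 Ω (p k) q := by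
  simp only [l2, Finset.sum_apply, Pi.smul_apply, sum_inner, inner_smul_left]
  rw [integral_finsetSum]
  · simp [integral_const_mul]
  · intro k hk
    exact (integrable_inner_of_memLp (hp k hk) hq).const_mul _

theorem l2_sum_right {ι : Type*} (s : Finset ι) {Ω : Set Plane} {p : ι → Plane → F}
    {q : Plane → F} (hp : ∀ k ∈ s, MemLp (p k) 2 (volume.restrict Ω))
    (hq : MemLp q 2 (volume.restrict Ω)) (c : ι → ℝ) :
    l2 Ω q (∑ k ∈ s, c k • p k) = ∑ k ∈ s, c k * l2 Ω q (p k) := by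
  rw [l2_comm, l2_sum_left s hp hq]
  simp only [l2_comm Ω q]

end Lebesgue

namespace TriMesh

variable {T : Type*} [Fintype T] {Ω : Set Plane} (M : TriMesh T Ω)

/-- A closed triangle need not lie in the open set `Ω`, but its interior does, and the two differ by
a null set. -/
theorem setIntegral_eq_setIntegral_cell (hΩ : IsOpen Ω) (hc : Convex ℝ Ω) (K : T)
    {E : Type*} [NormedAddCommGroup E] [NormedSpace ℝ E] {f : Plane → E}
    (hf : ∀ᵐ x ∂volume.restrict (Ω \ M.cell K), f x = 0) :
    ∫ x in Ω, f x = ∫ x in M.cell K, f x := by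
  have hae : interior (M.cell K) =ᵐ[volume] M.cell K := interior_hull_ae_eq (M.tri K)
  rw [← setIntegral_congr_set hae]
  refine setIntegral_eq_of_subset_of_ae_sdiff_eq_zero hΩ.measurableSet.nullMeasurableSet
    (M.interior_cell_subset hΩ hc K) ?_
  rw [ae_restrict_iff' (hΩ.measurableSet.diff (M.measurableSet_cell K))] at hf
  filter_upwards [hf, hae.mem_iff] with x hx h1 h2
  exact hx ⟨h2.1, fun h3 => h2.2 (h1.2 h3)⟩

/-- `|K \ Ω| = 0`. -/
theorem cell_inter_ae_eq (hΩ : IsOpen Ω) (hc : Convex ℝ Ω) (K : T) :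
    (M.cell K ∩ Ω : Set Plane) =ᵐ[volume] M.cell K := by
  have hae : interior (M.cell K) =ᵐ[volume] M.cell K := interior_hull_ae_eq (M.tri K)
  filter_upwards [hae.mem_iff] with x h1
  exact propext ⟨fun h => h.1, fun h => ⟨h, M.interior_cell_subset hΩ hc K (h1.2 h)⟩⟩

theorem restrict_restrict_cell (hΩ : IsOpen Ω) (hc : Convex ℝ Ω) (K : T) :
    (volume.restrict Ω).restrict (M.cell K) = volume.restrict (M.cell K) := by
  rw [Measure.restrict_restrict (M.measurableSet_cell K)]
  exact Measure.restrict_congr_set (M.cell_inter_ae_eq hΩ hc K)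

theorem restrict_cell_le (hΩ : IsOpen Ω) (hc : Convex ℝ Ω) (K : T) :
    volume.restrict (M.cell K) ≤ volume.restrict Ω := by
  rw [← M.restrict_restrict_cell hΩ hc K]
  exact Measure.restrict_le_self

theorem memLp_indicator_cell (hΩ : IsOpen Ω) (hc : Convex ℝ Ω) {K : T} {E : Type*}
    [NormedAddCommGroup E] {f : Plane → E} (hf : MemLp f 2 (volume.restrict (M.cell K))) :
    MemLp ((M.cell K).indicator f) 2 (volume.restrict Ω) := by
  rw [memLp_indicator_iff_restrict (M.measurableSet_cell K), M.restrict_restrict_cell hΩ hc]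
  exact hf

theorem memLp_of_ae_zero (hΩ : IsOpen Ω) (hc : Convex ℝ Ω) {K : T} {E : Type*}
    [NormedAddCommGroup E] {f : Plane → E} (hf : MemLp f 2 (volume.restrict (M.cell K)))
    (h0 : ∀ᵐ x ∂volume.restrict (Ω \ M.cell K), f x = 0) : MemLp f 2 (volume.restrict Ω) := by
  refine (M.memLp_indicator_cell hΩ hc hf).ae_eq ?_
  rw [Filter.EventuallyEq, ae_restrict_iff' hΩ.measurableSet]
  rw [ae_restrict_iff' (hΩ.measurableSet.diff (M.measurableSet_cell K))] at h0
  filter_upwards [h0] with x hx hxΩ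
  by_cases h : x ∈ M.cell K
  · rw [indicator_of_mem h]
  · rw [indicator_of_notMem h, hx ⟨hxΩ, h⟩]

theorem ae_notMem_cell {K L : T} (h : K ≠ L) : ∀ᵐ x ∂volume.restrict (M.cell K), x ∉ M.cell L := by
  rw [ae_restrict_iff' (M.measurableSet_cell K)]
  have := measure_eq_zero_iff_ae_notMem.1 (M.volume_cell_inter_cell h)
  filter_upwards [this] with x hx hK hL using hx ⟨hK, hL⟩

theorem area_pos (K : T) : 0 < M.area K := volume_real_hull_pos (M.tri K)

theorem memLp_ind (hΩ : IsOpen Ω) (hc : Convex ℝ Ω) (K : T) :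
    MemLp (M.ind K) 2 (volume.restrict Ω) :=
  M.memLp_indicator_cell hΩ hc (memLp_restrict_of_continuous (M.measurableSet_cell K)
    (isCompact_hull (M.tri K)).isBounded continuous_const)

theorem l2_ind (hΩ : IsOpen Ω) (hc : Convex ℝ Ω) (f : Plane → ℝ) (K : T) :
    l2 Ω f (M.ind K) = ∫ x in M.cell K, f x := by
  rw [l2, M.setIntegral_eq_setIntegral_cell hΩ hc K]
  · refine setIntegral_congr_fun (M.measurableSet_cell K) fun x hx => ?_
    simp [ind, indicator_of_mem hx]
  · filter_upwards [ae_restrict_mem (hΩ.measurableSet.diff (M.measurableSet_cell K))] with x hx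
    simp [ind, indicator_of_notMem hx.2]

theorem l2_sum_ind (hΩ : IsOpen Ω) (hc : Convex ℝ Ω) {f : Plane → ℝ}
    (hf : MemLp f 2 (volume.restrict Ω)) (V : T → ℝ) :
    l2 Ω f (∑ K, V K • M.ind K) = ∑ K, V K * ∫ x in M.cell K, f x := by
  rw [l2_sum_right _ (fun K _ => M.memLp_ind hΩ hc K) hf]
  simp only [M.l2_ind hΩ hc]

theorem setIntegral_cell_sum_indicator {δ : T → Plane → ℝ} (c : T → ℝ) (K : T) :
    ∫ x in M.cell K, (∑ L, c L • (M.cell L).indicator (δ L)) x = c K * ∫ x in M.cell K, δ K x := by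
  rw [← integral_const_mul]
  refine setIntegral_congr_ae (M.measurableSet_cell K) ?_
  have h : ∀ᵐ x ∂volume.restrict (M.cell K), ∀ L, K ≠ L → x ∉ M.cell L := by
    rw [ae_all_iff]
    intro L
    by_cases hKL : K = L
    · simp [hKL]
    · filter_upwards [M.ae_notMem_cell hKL] with x hx _ using hx
  rw [ae_restrict_iff' (M.measurableSet_cell K)] at h
  filter_upwards [h] with x hx hxK
  rw [Finset.sum_apply, Finset.sum_eq_single K]
  · rw [Pi.smul_apply, indicator_of_mem hxK, smul_eq_mul]
  · intro L _ hL
    rw [Pi.smul_apply, indicator_of_notMem (hx hxK L hL.symm), smul_zero]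
  · simp

end TriMesh

/-! ### Families of local fields -/

/-- The combination of local fields with given coefficients. -/
def combine {T : Type*} [Fintype T] (ψ : T → Fin 3 → Plane → Plane) (c : T → Fin 3 → ℝ) :
    Plane → Plane := ∑ K, ∑ i, c K i • ψ K i

namespace EdgeNormals

variable {T : Type*} [Fintype T] {Ω : Set Plane} {M : TriMesh T Ω} (N : EdgeNormals M)

/-- The local coefficients of an assembled field. -/
def localCoeff (P : M.Edge → ℝ) (K : T) (i : Fin 3) : ℝ := N.ε K i * P (M.edge K i)

-- Each pair `(K, i)` belongs to exactly one edge, so a sum over edges of assembled quantities is a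
-- sum over pairs.
open Classical in
theorem sum_localized {A : Type*} [AddCommMonoid A] (G : M.Edge → T → Fin 3 → A) :
    ∑ a, ∑ K, ∑ i, (if M.edge K i = a then G a K i else 0) =
      ∑ K, ∑ i, G (M.edge K i) K i := by
  rw [Finset.sum_comm]
  refine Finset.sum_congr rfl fun K _ => ?_
  rw [Finset.sum_comm]
  refine Finset.sum_congr rfl fun i _ => ?_
  rw [Finset.sum_ite_eq]
  simp

theorem sum_smul_assemble (ψ : T → Fin 3 → Plane → Plane) (P : M.Edge → ℝ) :
    ∑ a, P a • N.assemble ψ a = combine ψ (N.localCoeff P) := by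
  classical
  rw [combine]
  simp only [assemble, Finset.smul_sum, smul_ite, smul_zero]
  rw [sum_localized (fun a K i => P a • N.ε K i • ψ K i)]
  simp only [localCoeff, smul_smul, mul_comm]

theorem assemble_eq_combine [DecidableEq M.Edge] (ψ : T → Fin 3 → Plane → Plane) (a : M.Edge) :
    N.assemble ψ a = combine ψ (N.localCoeff (Pi.single a 1)) := by
  rw [← N.sum_smul_assemble ψ, Finset.sum_eq_single a]
  · simp
  · intro b _ hb; simp [hb]
  · simp

end EdgeNormals

/-- A family of square-integrable fields supported by the triangles, with divergence `δ K` in `K`,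
whose flux density through the edge `i` is a symmetric function `g` of the parameter of the edge and
which have no flux through the two other edges. -/
structure LocalFamily {T : Type*} [Fintype T] {Ω : Set Plane} (M : TriMesh T Ω) (g : ℝ → ℝ)
    (δ : T → Plane → ℝ) (ψ : T → Fin 3 → Plane → Plane) : Prop where
  memLp : ∀ K i, MemLp (ψ K i) 2 (volume.restrict (M.cell K))
  ae_zero : ∀ K i, ∀ᵐ x ∂(volume.restrict (Ω \ M.cell K)), ψ K i x = 0
  memLp_div : ∀ K, MemLp (δ K) 2 (volume.restrict (M.cell K))
  integrable : IntervalIntegrable g volume 0 1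
  symm : ∀ s ∈ Ioo (0 : ℝ) 1, g s = g (1 - s)
  green : ∀ K i (v : Plane → ℝ), ContDiff ℝ ∞ v →
    (∫ x in M.cell K, ⟪ψ K i x, gradient v x⟫) + ∫ x in M.cell K, δ K x * v x =
      ∫ s in (0 : ℝ)..1, g s * v (edgePoint (M.tri K) i s)
  integral_div : ∀ K, ∫ x in M.cell K, δ K x = 1

/-- The divergence of a combination of the fields of a local family. -/
def TriMesh.combineDiv {T : Type*} [Fintype T] {Ω : Set Plane} (M : TriMesh T Ω)
    (δ : T → Plane → ℝ) (c : T → Fin 3 → ℝ) : Plane → ℝ :=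
  ∑ K, (∑ i, c K i) • (M.cell K).indicator (δ K)

namespace LocalFamily

variable {T : Type*} [Fintype T] {Ω : Set Plane} {M : TriMesh T Ω} {g : ℝ → ℝ}
  {δ : T → Plane → ℝ} {ψ : T → Fin 3 → Plane → Plane}

theorem memLp_domain (h : LocalFamily M g δ ψ) (hΩ : IsOpen Ω) (hc : Convex ℝ Ω) (K : T)
    (i : Fin 3) : MemLp (ψ K i) 2 (volume.restrict Ω) :=
  M.memLp_of_ae_zero hΩ hc (h.memLp K i) (h.ae_zero K i)

theorem memLp_combine (h : LocalFamily M g δ ψ) (hΩ : IsOpen Ω) (hc : Convex ℝ Ω)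
    (c : T → Fin 3 → ℝ) : MemLp (combine ψ c) 2 (volume.restrict Ω) :=
  memLp_finsetSum' _ fun K _ => memLp_finsetSum' _ fun i _ =>
    (h.memLp_domain hΩ hc K i).const_smul _

theorem memLp_combineDiv (h : LocalFamily M g δ ψ) (hΩ : IsOpen Ω) (hc : Convex ℝ Ω)
    (c : T → Fin 3 → ℝ) : MemLp (M.combineDiv δ c) 2 (volume.restrict Ω) :=
  memLp_finsetSum' _ fun K _ => (M.memLp_indicator_cell hΩ hc (h.memLp_div K)).const_smul _

theorem l2_combine_left (h : LocalFamily M g δ ψ) (hΩ : IsOpen Ω) (hc : Convex ℝ Ω)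
    (c : T → Fin 3 → ℝ) {q : Plane → Plane} (hq : MemLp q 2 (volume.restrict Ω)) :
    l2 Ω (combine ψ c) q = ∑ K, ∑ i, c K i * l2 Ω (ψ K i) q := by
  have h1 : combine ψ c = ∑ K, (1 : ℝ) • ∑ i, c K i • ψ K i := by simp [combine]
  have h2 : ∀ K ∈ Finset.univ, MemLp (∑ i, c K i • ψ K i) 2 (volume.restrict Ω) := fun K _ =>
    memLp_finsetSum' _ fun i _ => (h.memLp_domain hΩ hc K i).const_smul _
  rw [h1, l2_sum_left Finset.univ h2 hq]
  refine Finset.sum_congr rfl fun K _ => ?_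
  rw [one_mul, l2_sum_left _ (fun i _ => h.memLp_domain hΩ hc K i) hq]

theorem l2_local (h : LocalFamily M g δ ψ) (hΩ : IsOpen Ω) (hc : Convex ℝ Ω) (K : T) (i : Fin 3)
    (q : Plane → Plane) : l2 Ω (ψ K i) q = ∫ x in M.cell K, ⟪ψ K i x, q x⟫ := by
  rw [l2, M.setIntegral_eq_setIntegral_cell hΩ hc K]
  filter_upwards [h.ae_zero K i] with x hx
  rw [hx, inner_zero_left]

/-- The fluxes of an assembled field cancel when they are tested with a function that vanishes on
the boundary. -/
theorem sum_localCoeff_mul_eq_zero (hΩ : IsOpen Ω) (hc : Convex ℝ Ω) (N : EdgeNormals M)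
    (P : M.Edge → ℝ) (E : T → Fin 3 → ℝ)
    (hE0 : ∀ K i, M.IsBoundary (M.edge K i) → E K i = 0)
    (hE : ∀ K i L j, M.edge K i = M.edge L j → E K i = E L j) :
    ∑ K, ∑ i, N.localCoeff P K i * E K i = 0 := by
  classical
  have hloc := EdgeNormals.sum_localized (M := M) fun a K i => P a * (N.ε K i * E K i)
  rw [show ∑ K, ∑ i, N.localCoeff P K i * E K i =
    ∑ K, ∑ i, P (M.edge K i) * (N.ε K i * E K i) from
      Finset.sum_congr rfl fun K _ => Finset.sum_congr rfl fun i _ => by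
        simp only [EdgeNormals.localCoeff]; ring, ← hloc]
  refine Finset.sum_eq_zero fun a _ => ?_
  -- Edge by edge: a single zero term on the boundary, two terms with opposite signs inside.
  rcases N.isBoundary_or_isInnerCoboundary hΩ a with ⟨hb, K, i, rfl⟩ | ⟨K, i, L, j, hin⟩
  · rw [EdgeNormals.sum_edge_of_isBoundary hΩ hc (fun K' i' => P (M.edge K i) * (N.ε K' i' * E K' i')) hb,
      hE0 K i hb]
    ring
  · have hKL := N.ne_of_isInnerCoboundary hin
    obtain ⟨-, rfl, h2, -, -⟩ := hin
    rw [EdgeNormals.sum_edge_of_ne (fun K' i' => P (M.edge K i) * (N.ε K' i' * E K' i')) hKL h2.symm N,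
      hE L j K i h2, N.ε_eq_neg hKL h2.symm]
    ring

/-- Two triangles may run through their common edge in opposite directions; the symmetry of `g`
makes this harmless. -/
theorem integral_edge_eq (h : LocalFamily M g δ ψ) {K L : T} {i j : Fin 3}
    (he : M.edge K i = M.edge L j) (v : Plane → ℝ) :
    ∫ s in (0 : ℝ)..1, g s * v (edgePoint (M.tri K) i s) =
      ∫ s in (0 : ℝ)..1, g s * v (edgePoint (M.tri L) j s) := by
  rcases M.edge_eq_iff.1 he with ⟨h1, h2⟩ | ⟨h1, h2⟩
  · simp only [TriMesh.W] at h1 h2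
    simp only [edgePoint, h1, h2]
  · simp only [TriMesh.W] at h1 h2
    rw [← integral_mul_comp_one_sub h.symm]
    refine intervalIntegral.integral_congr fun s _ => ?_
    simp only [edgePoint, h1, h2, sub_sub_cancel, add_comm]

/-- Sum of the Green formulas of the triangles. The edge terms cancel on internal edges and vanish
on boundary edges, where the test function is zero. -/
theorem isWeakDiv_combine (h : LocalFamily M g δ ψ) (hΩ : IsOpen Ω) (hb : Bornology.IsBounded Ω)
    (hc : Convex ℝ Ω) (N : EdgeNormals M) (P : M.Edge → ℝ) :
    IsWeakDiv Ω (combine ψ (N.localCoeff P)) (M.combineDiv δ (N.localCoeff P)) := by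
  intro v hv _ hvs
  have hvm : MemLp v 2 (volume.restrict Ω) :=
    memLp_restrict_of_continuous hΩ.measurableSet hb hv.continuous
  have hgm : MemLp (gradient v) 2 (volume.restrict Ω) :=
    memLp_restrict_of_continuous hΩ.measurableSet hb (continuous_gradient hv)
  have h1 : ∫ x in Ω, ⟪combine ψ (N.localCoeff P) x, gradient v x⟫ =
      ∑ K, ∑ i, N.localCoeff P K i * ∫ x in M.cell K, ⟪ψ K i x, gradient v x⟫ := by
    have := h.l2_combine_left hΩ hc (N.localCoeff P) hgm
    simp only [h.l2_local hΩ hc] at this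
    exact this
  have h2 : ∫ x in Ω, M.combineDiv δ (N.localCoeff P) x * v x =
      ∑ K, (∑ i, N.localCoeff P K i) * ∫ x in M.cell K, δ K x * v x := by
    have h3 := l2_sum_left Finset.univ
      (fun K _ => M.memLp_indicator_cell hΩ hc (h.memLp_div K)) hvm
      (fun K => ∑ i, N.localCoeff P K i)
    have h4 : ∀ K, l2 Ω ((M.cell K).indicator (δ K)) v = ∫ x in M.cell K, δ K x * v x := by
      intro K
      rw [l2, M.setIntegral_eq_setIntegral_cell hΩ hc K]
      · refine setIntegral_congr_fun (M.measurableSet_cell K) fun x hx => ?_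
        simp [indicator_of_mem hx, mul_comm]
      · filter_upwards [ae_restrict_mem (hΩ.measurableSet.diff (M.measurableSet_cell K))] with x hx
        simp [indicator_of_notMem hx.2]
    simp only [h4] at h3
    rw [← h3, l2]
    exact integral_congr_ae (Filter.Eventually.of_forall fun x => by
      simp [TriMesh.combineDiv, mul_comm])
  have h5 := sum_localCoeff_mul_eq_zero hΩ hc N P
    (fun K i => ∫ s in (0 : ℝ)..1, g s * v (edgePoint (M.tri K) i s)) (by
      intro K i hbd
      have : ∀ s ∈ uIcc (0 : ℝ) 1, g s * v (edgePoint (M.tri K) i s) = 0 := by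
        intro s hs
        rw [uIcc_of_le zero_le_one] at hs
        have hf : edgePoint (M.tri K) i s ∈ frontier Ω := hbd (M.edgePoint_mem_seg K i hs.1 hs.2)
        rw [hΩ.frontier_eq] at hf
        rw [image_eq_zero_of_notMem_tsupport fun hx => hf.2 (hvs hx), mul_zero]
      rw [intervalIntegral.integral_congr (g := fun _ => 0) this]
      simp)
    (fun K i L j he => h.integral_edge_eq he v)
  simp only [← h.green _ _ v hv, mul_add, Finset.sum_add_distrib] at h5
  rw [h1, h2]
  simp only [Finset.sum_mul]
  linarith

theorem div_combine_ae_eq (h : LocalFamily M g δ ψ) (hΩ : IsOpen Ω) (hb : Bornology.IsBounded Ω)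
    (hc : Convex ℝ Ω) (N : EdgeNormals M) (P : M.Edge → ℝ) :
    div Ω (combine ψ (N.localCoeff P)) =ᵐ[volume.restrict Ω] M.combineDiv δ (N.localCoeff P) :=
  div_ae_eq hΩ hb (h.memLp_combineDiv hΩ hc _) (h.isWeakDiv_combine hΩ hb hc N P)

/-- Against piecewise constants only the mass of `δ K` matters, and it is one; hence the divergence
acts alike on `RT` and `RT*`. -/
theorem l2_sum_ind_div (h : LocalFamily M g δ ψ) (hΩ : IsOpen Ω) (hb : Bornology.IsBounded Ω)
    (hc : Convex ℝ Ω) (N : EdgeNormals M) (P : M.Edge → ℝ) (U : T → ℝ) :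
    l2 Ω (∑ K, U K • M.ind K) (div Ω (combine ψ (N.localCoeff P))) =
      ∑ K, U K * ∑ i, N.localCoeff P K i := by
  have h1 : l2 Ω (∑ K, U K • M.ind K) (div Ω (combine ψ (N.localCoeff P))) =
      l2 Ω (M.combineDiv δ (N.localCoeff P)) (∑ K, U K • M.ind K) := by
    rw [l2_comm]
    refine integral_congr_ae ?_
    filter_upwards [h.div_combine_ae_eq hΩ hb hc N P] with x hx
    rw [hx]
  rw [h1, M.l2_sum_ind hΩ hc (h.memLp_combineDiv hΩ hc _)]
  refine Finset.sum_congr rfl fun K _ => ?_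
  rw [TriMesh.combineDiv, M.setIntegral_cell_sum_indicator, h.integral_div, mul_one]

/-- The normal trace on the boundary of `K` of a combination of the fields of `K`. -/
theorem hasNormalTrace_of_ae_eq (h : LocalFamily M g δ ψ) (K : T) (c : Fin 3 → ℝ)
    {p : Plane → Plane}
    (hp : p =ᵐ[volume.restrict (M.cell K)] fun x => ∑ i, c i • ψ K i x) :
    HasNormalTrace (M.tri K) p (fun i s => c i * (g s / edgeLength (M.tri K) i)) := by
  have hae : interior (hull (M.tri K)) =ᵐ[volume] M.cell K := interior_hull_ae_eq (M.tri K)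
  have hGreen : ∀ v : Plane → ℝ, ContDiff ℝ ∞ v →
      (∫ x in interior (hull (M.tri K)), ⟪p x, gradient v x⟫) +
        (∫ x in interior (hull (M.tri K)), ((∑ i, c i) * δ K x) * v x) =
      ∑ i, edgeLength (M.tri K) i *
        ∫ s in (0 : ℝ)..1, c i * (g s / edgeLength (M.tri K) i) * v (edgePoint (M.tri K) i s) := by
    intro v hv
    have hgm : MemLp (gradient v) 2 (volume.restrict (M.cell K)) :=
      memLp_restrict_of_continuous (M.measurableSet_cell K) (isCompact_hull _).isBounded
        (continuous_gradient hv)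
    rw [setIntegral_congr_set hae, setIntegral_congr_set hae]
    have h1 : ∫ x in M.cell K, ⟪p x, gradient v x⟫ =
        ∑ i, c i * ∫ x in M.cell K, ⟪ψ K i x, gradient v x⟫ := by
      refine Eq.trans ?_ (l2_sum_left Finset.univ (fun i _ => h.memLp K i) hgm c)
      refine integral_congr_ae ?_
      filter_upwards [hp] with x hx
      rw [hx]; simp
    have h2 : ∫ x in M.cell K, ((∑ i, c i) * δ K x) * v x =
        ∑ i, c i * ∫ x in M.cell K, δ K x * v x := by
      rw [← Finset.sum_mul, ← integral_const_mul]
      simp only [mul_assoc]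
    rw [h1, h2, ← Finset.sum_add_distrib]
    refine Finset.sum_congr rfl fun i _ => ?_
    rw [← mul_add, h.green K i v hv, ← intervalIntegral.integral_const_mul,
      ← intervalIntegral.integral_const_mul]
    refine intervalIntegral.integral_congr fun s _ => ?_
    have := (edgeLength_pos (M.tri K) i).ne'
    field_simp
  refine ⟨fun i => (h.integrable.div_const _).const_mul _, fun x => (∑ i, c i) * δ K x, ?_, ?_,
    hGreen⟩
  · rw [Measure.restrict_congr_set hae]
    exact (h.memLp_div K).const_mul _
  -- For a test function supported in the open triangle the edge terms vanish, so the Green formula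
  -- contains the weak divergence.
  · intro v hv _ hvs
    refine eq_neg_of_add_eq_zero_left ((hGreen v hv).trans (Finset.sum_eq_zero fun i _ => ?_))
    have h0 : ∀ s ∈ uIcc (0 : ℝ) 1,
        c i * (g s / edgeLength (M.tri K) i) * v (edgePoint (M.tri K) i s) = 0 := by
      intro s hs
      rw [uIcc_of_le zero_le_one] at hs
      have hnot : edgePoint (M.tri K) i s ∉ interior (hull (M.tri K)) := by
        intro hmem
        have h0 := (mem_interior_hull_iff _).1 hmem i
        obtain ⟨h1, -, -⟩ := bary_conePoint (M.tri K) i s 1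
        rw [conePoint, one_smul, add_sub_cancel] at h1
        rw [h1] at h0
        linarith
      rw [image_eq_zero_of_notMem_tsupport fun hx => hnot (hvs hx), mul_zero]
    rw [intervalIntegral.integral_congr (g := fun _ => 0) h0]
    simp

end LocalFamily

/-! ### The Raviart-Thomas fields and the stiffness coefficients -/

namespace TriMesh

variable {T : Type*} [Fintype T] {Ω : Set Plane} (M : TriMesh T Ω)

/-- The Raviart-Thomas fields form a local family. -/
theorem localFamily_localRT (hΩ : IsOpen Ω) :
    LocalFamily M (fun _ => 1) (fun K _ => (M.area K)⁻¹) M.localRT where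
  memLp K i := by
    have h : MemLp (fun x => (2 * M.area K)⁻¹ • (x - M.W K i)) 2 (volume.restrict (M.cell K)) :=
      memLp_restrict_of_continuous (M.measurableSet_cell K) (isCompact_hull (M.tri K)).isBounded
        (by fun_prop)
    refine h.ae_eq ?_
    filter_upwards [ae_restrict_mem (M.measurableSet_cell K)] with x hx
    rw [localRT, indicator_of_mem hx]
  ae_zero K i := by
    filter_upwards [ae_restrict_mem (hΩ.measurableSet.diff (M.measurableSet_cell K))] with x hx
    rw [localRT, indicator_of_notMem hx.2]
  memLp_div K := memLp_restrict_of_continuous (M.measurableSet_cell K)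
    (isCompact_hull (M.tri K)).isBounded continuous_const
  integrable := intervalIntegrable_const
  symm _ _ := rfl
  green K i v hv := by
    have h := setIntegral_hull_inner_sub_gradient (M.tri K) i v hv
    have ha : 0 < volume.real (hull (M.tri K)) := M.area_pos K
    have h1 : ∫ x in M.cell K, ⟪M.localRT K i x, gradient v x⟫ =
        (2 * M.area K)⁻¹ * ∫ x in hull (M.tri K), ⟪x - (M.tri K).points i, gradient v x⟫ := by
      rw [← integral_const_mul]
      refine setIntegral_congr_fun (M.measurableSet_cell K) fun x hx => ?_
      rw [localRT, indicator_of_mem hx, inner_smul_left]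
      rfl
    rw [h1, integral_const_mul]
    simp only [one_mul]
    change (2 * volume.real (hull (M.tri K)))⁻¹ * _ + (volume.real (hull (M.tri K)))⁻¹ *
      (∫ x in hull (M.tri K), v x) = _
    field_simp
    linarith
  integral_div K := by
    rw [setIntegral_const, smul_eq_mul]
    exact mul_inv_cancel₀ (M.area_pos K).ne'

open Classical in
/-- The value of `(φ_a, φ*_a)₀`. -/
def stiff (a : M.Edge) : ℝ :=
  ∑ K, ∑ i, if M.edge K i = a then Real.cot (M.θ K i) / 2 else 0

theorem cot_pos (hacute : ∀ K i, 0 < M.θ K i ∧ M.θ K i < Real.pi / 2) (K : T) (i : Fin 3) :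
    0 < Real.cot (M.θ K i) := by
  obtain ⟨h1, h2⟩ := hacute K i
  rw [Real.cot_eq_cos_div_sin]
  exact div_pos (Real.cos_pos_of_mem_Ioo ⟨by linarith [Real.pi_pos], h2⟩)
    (Real.sin_pos_of_pos_of_lt_pi h1 (by linarith [Real.pi_pos]))

theorem stiff_pos (hacute : ∀ K i, 0 < M.θ K i ∧ M.θ K i < Real.pi / 2) (a : M.Edge) :
    0 < M.stiff a := by
  classical
  obtain ⟨⟨K, i⟩, rfl⟩ := M.edge_surjective a
  have hpos : ∀ L j, 0 ≤ if M.edge L j = M.edge K i then Real.cot (M.θ L j) / 2 else 0 := by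
    intro L j
    have := M.cot_pos hacute L j
    split_ifs <;> positivity
  have h1 : 0 < Real.cot (M.θ K i) / 2 := by have := M.cot_pos hacute K i; positivity
  refine lt_of_lt_of_le h1 ?_
  refine le_trans ?_ (Finset.single_le_sum (fun L _ => Finset.sum_nonneg fun j _ => hpos L j)
    (Finset.mem_univ K))
  refine le_trans (le_of_eq ?_) (Finset.single_le_sum (fun j _ => hpos K j) (Finset.mem_univ i))
  simp

theorem stiff_of_isBoundary (hΩ : IsOpen Ω) (hc : Convex ℝ Ω) {K : T} {i : Fin 3}
    (h : M.IsBoundary (M.edge K i)) : M.stiff (M.edge K i) = Real.cot (M.θ K i) / 2 :=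
  EdgeNormals.sum_edge_of_isBoundary hΩ hc (fun K i => Real.cot (M.θ K i) / 2) h

theorem stiff_of_ne (N : EdgeNormals M) {K L : T} {i j : Fin 3} (hKL : K ≠ L)
    (he : M.edge K i = M.edge L j) :
    M.stiff (M.edge K i) = (Real.cot (M.θ K i) + Real.cot (M.θ L j)) / 2 := by
  rw [add_div]
  exact EdgeNormals.sum_edge_of_ne (fun K i => Real.cot (M.θ K i) / 2) hKL he N

end TriMesh

namespace LocalFamily

variable {T : Type*} [Fintype T] {Ω : Set Plane} {M : TriMesh T Ω} {g : ℝ → ℝ}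
  {δ : T → Plane → ℝ} {ψ : T → Fin 3 → Plane → Plane}

theorem l2_localRT_of_ne (h : LocalFamily M g δ ψ) (hΩ : IsOpen Ω) (hc : Convex ℝ Ω) {K L : T}
    (hKL : K ≠ L) (i j : Fin 3) : l2 Ω (ψ K i) (M.localRT L j) = 0 := by
  rw [h.l2_local hΩ hc]
  refine integral_eq_zero_of_ae ?_
  filter_upwards [M.ae_notMem_cell hKL] with x hx
  rw [TriMesh.localRT, indicator_of_notMem hx, inner_zero_right]; rfl

/-- Green formula with the potential `|x - W_{K,j}|²`: the condition on `δ K` removes the volume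
term and the moments of `g` evaluate the edge term. -/
theorem l2_localRT_self (h : LocalFamily M g δ ψ) (hΩ : IsOpen Ω) (hc : Convex ℝ Ω)
    (hg_one : ∫ s in (0 : ℝ)..1, g s = 1) (hg_sq : ∫ s in (0 : ℝ)..1, g s * s ^ 2 = 0)
    (hδ_sq : ∀ K i, ∫ x in M.cell K, δ K x * ‖x - M.W K i‖ ^ 2 = 0) (K : T) (i j : Fin 3) :
    l2 Ω (ψ K i) (M.localRT K j) = if j = i then Real.cot (M.θ K i) / 2 else 0 := by
  have hv : ContDiff ℝ ∞ fun x : Plane => ‖x - M.W K j‖ ^ 2 :=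
    (contDiff_id.sub contDiff_const).norm_sq ℝ
  have hgreen := h.green K i _ hv
  rw [hδ_sq, add_zero] at hgreen
  have hval := integral_mul_norm_edgePoint_sub_sq (Q := M.tri K) h.integrable hg_one hg_sq h.symm i j
  have harea : M.area K = |orient (M.tri K)| / 2 := volume_real_hull (M.tri K)
  have ho : 0 < |orient (M.tri K)| := abs_pos.2 (orient_ne_zero _)
  have h1 : ∫ x in M.cell K, ⟪ψ K i x, M.localRT K j x⟫ =
      (4 * M.area K)⁻¹ *
        ∫ x in M.cell K, ⟪ψ K i x, gradient (fun x : Plane => ‖x - M.W K j‖ ^ 2) x⟫ := by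
    rw [← integral_const_mul]
    refine setIntegral_congr_fun (M.measurableSet_cell K) fun x hx => ?_
    have hd : HasFDerivAt (fun x : Plane => ‖x - M.W K j‖ ^ 2) _ x :=
      ((hasFDerivAt_id x).sub_const (M.W K j)).norm_sq
    rw [TriMesh.localRT, indicator_of_mem hx, inner_gradient, hd.fderiv, inner_smul_right,
      real_inner_comm]
    simp only [smul_apply, ContinuousLinearMap.comp_apply, innerSL_apply_apply,
      ContinuousLinearMap.coe_id', id, nsmul_eq_mul]
    have := (M.area_pos K).ne'
    field_simp
    push_cast
    ring
  rw [h.l2_local hΩ hc, h1, hgreen]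
  refine (congrArg _ hval).trans ?_
  rw [TriMesh.θ, TriMesh.W, TriMesh.W, TriMesh.W, cot_angle_eq_div_orient, harea]
  split_ifs
  · field_simp
    norm_num
  · simp

/-- Only products with the same triangle and the same vertex survive; in them the sign `ε` appears
squared. -/
theorem l2_combine_combine (h : LocalFamily M g δ ψ) (hΩ : IsOpen Ω) (hc : Convex ℝ Ω)
    (hg_one : ∫ s in (0 : ℝ)..1, g s = 1) (hg_sq : ∫ s in (0 : ℝ)..1, g s * s ^ 2 = 0)
    (hδ_sq : ∀ K i, ∫ x in M.cell K, δ K x * ‖x - M.W K i‖ ^ 2 = 0) (N : EdgeNormals M)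
    (P R : M.Edge → ℝ) :
    l2 Ω (combine ψ (N.localCoeff P)) (combine M.localRT (N.localCoeff R)) =
      ∑ a, P a * R a * M.stiff a := by
  classical
  have hRT := M.localFamily_localRT hΩ
  rw [h.l2_combine_left hΩ hc _ (hRT.memLp_combine hΩ hc _)]
  simp only [TriMesh.stiff, Finset.mul_sum, mul_ite, mul_zero]
  rw [EdgeNormals.sum_localized fun a K i => P a * R a * (Real.cot (M.θ K i) / 2)]
  refine Finset.sum_congr rfl fun K _ => Finset.sum_congr rfl fun i _ => ?_
  rw [l2_comm, hRT.l2_combine_left hΩ hc _ (h.memLp_domain hΩ hc K i),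
    Finset.sum_eq_single K, Finset.sum_eq_single i]
  · rw [l2_comm, h.l2_localRT_self hΩ hc hg_one hg_sq hδ_sq, if_pos rfl, EdgeNormals.localCoeff,
      EdgeNormals.localCoeff]
    linear_combination (P (M.edge K i) * R (M.edge K i) * (Real.cot (M.θ K i) / 2)) *
      N.ε_mul_self K i
  · intro j _ hj
    rw [l2_comm, h.l2_localRT_self hΩ hc hg_one hg_sq hδ_sq, if_neg hj, mul_zero]
  · simp
  · intro L _ hL
    refine Finset.sum_eq_zero fun j _ => ?_
    rw [l2_comm, h.l2_localRT_of_ne hΩ hc hL.symm, mul_zero]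
  · simp

/-! ### The dual basis -/

theorem combine_ae_eq (h : LocalFamily M g δ ψ) (hΩ : IsOpen Ω) (hc : Convex ℝ Ω)
    (c : T → Fin 3 → ℝ) (K : T) :
    combine ψ c =ᵐ[volume.restrict (M.cell K)] fun x => ∑ i, c K i • ψ K i x := by
  have h0 : ∀ᵐ x ∂volume.restrict (M.cell K), ∀ L, K ≠ L → ∀ i, ψ L i x = 0 := by
    rw [ae_all_iff]
    intro L
    by_cases hKL : K = L
    · simp [hKL]
    · have h1 : ∀ᵐ x ∂volume.restrict (M.cell K), ∀ i, ψ L i x = 0 := by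
        rw [ae_all_iff]
        intro i
        have h2 := h.ae_zero L i
        rw [ae_restrict_iff' (hΩ.measurableSet.diff (M.measurableSet_cell L))] at h2
        have h3 := M.ae_notMem_cell hKL
        rw [← Measure.restrict_congr_set (M.cell_inter_ae_eq hΩ hc K)] at h3 ⊢
        filter_upwards [ae_restrict_of_ae h2, h3,
          ae_restrict_mem ((M.measurableSet_cell K).inter hΩ.measurableSet)] with x hx2 hx3 hx
        exact hx2 ⟨hx.2, hx3⟩
      filter_upwards [h1] with x hx _ using hx
  filter_upwards [h0] with x hx
  simp only [combine, Finset.sum_apply, Pi.smul_apply]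
  rw [Finset.sum_eq_single K]
  · intro L _ hL
    exact Finset.sum_eq_zero fun i _ => by rw [hx L hL.symm, smul_zero]
  · simp

theorem memHDiv_assemble (h : LocalFamily M g δ ψ) (hΩ : IsOpen Ω) (hb : Bornology.IsBounded Ω)
    (hc : Convex ℝ Ω) (N : EdgeNormals M) (a : M.Edge) : MemHDiv Ω (N.assemble ψ a) := by
  classical
  rw [N.assemble_eq_combine]
  exact ⟨h.memLp_combine hΩ hc _, _, h.memLp_combineDiv hΩ hc _, h.isWeakDiv_combine hΩ hb hc N _⟩

-- The sign occurs once in the assembly and once in the flux, so the two occurrences cancel.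
open Classical in
theorem hasFlux_assemble (h : LocalFamily M g δ ψ) (hΩ : IsOpen Ω) (hc : Convex ℝ Ω)
    (hg_one : ∫ s in (0 : ℝ)..1, g s = 1) (N : EdgeNormals M) (a b : M.Edge) :
    N.HasFlux (N.assemble ψ a) b (if a = b then 1 else 0) := by
  rintro K i rfl
  rw [N.assemble_eq_combine]
  refine ⟨_, h.hasNormalTrace_of_ae_eq K _ (h.combine_ae_eq hΩ hc _ K), ?_⟩
  have := (edgeLength_pos (M.tri K) i).ne'
  rw [intervalIntegral.integral_const_mul, intervalIntegral.integral_div, hg_one,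
    EdgeNormals.localCoeff, Pi.single_apply]
  by_cases hab : a = M.edge K i
  · rw [if_pos hab, if_pos hab.symm, mul_one]
    field_simp
    rw [sq, N.ε_mul_self]
  · rw [if_neg hab, if_neg (Ne.symm hab)]; simp

/-- Outside the triangles containing the edge the assembled field is zero. Conversely, on each of
these triangles the Raviart-Thomas function vanishes only at one vertex, so its support is not
smaller. -/
theorem essSupport_assemble_subset (h : LocalFamily M g δ ψ) (hΩ : IsOpen Ω) (hc : Convex ℝ Ω)
    (N : EdgeNormals M) (a : M.Edge) :
    essSupport Ω (N.assemble ψ a) ⊆ essSupport Ω (N.φ a) := by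
  classical
  have hRT := M.localFamily_localRT hΩ
  intro x hx
  have hmem : ∃ K i, M.edge K i = a ∧ x ∈ M.cell K := by
    by_contra! hall
    set C := ⋃ K ∈ {K : T | ∃ i, M.edge K i = a}, M.cell K with hC
    have hCclosed : IsClosed C := (toFinite _).isClosed_biUnion fun L _ => isClosed_hull _
    have hxC : x ∉ C := by
      intro h'
      obtain ⟨K, ⟨i, hi⟩, hK⟩ := mem_iUnion₂.1 h'
      exact hall K i hi hK
    refine hx Cᶜ (hCclosed.isOpen_compl.mem_nhds hxC) ?_
    have h0 : ∀ᵐ y ∂volume.restrict (Cᶜ ∩ Ω), ∀ K i, M.edge K i = a → ψ K i y = 0 := by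
      rw [ae_all_iff]; intro K
      rw [ae_all_iff]; intro i
      by_cases ha : M.edge K i = a
      · have hsub : Cᶜ ∩ Ω ⊆ Ω \ M.cell K := fun y hy =>
          ⟨hy.2, fun hyK => hy.1 (mem_biUnion (x := K) ⟨i, ha⟩ hyK)⟩
        filter_upwards [ae_mono (Measure.restrict_mono_set _ hsub) (h.ae_zero K i)] with y hy _
          using hy
      · simp [ha]
    filter_upwards [h0] with y hy
    simp only [EdgeNormals.assemble, Finset.sum_apply]
    refine Finset.sum_eq_zero fun K _ => Finset.sum_eq_zero fun i _ => ?_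
    split_ifs with ha
    · rw [Pi.smul_apply, hy K i ha, smul_zero]
    · rfl
  obtain ⟨K, i, rfl, hxK⟩ := hmem
  intro U hU hzero
  obtain ⟨V, hVU, hV, hxV⟩ := mem_nhds_iff.1 hU
  have hne : (V ∩ interior (M.cell K)).Nonempty := by
    have : x ∈ closure (interior (hull (M.tri K))) := by rw [closure_interior_hull]; exact hxK
    exact mem_closure_iff.1 this V hV hxV
  have hopen : IsOpen (V ∩ interior (M.cell K)) := hV.inter isOpen_interior
  have hpos : 0 < volume (V ∩ interior (M.cell K)) := hopen.measure_pos volume hne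
  have hsub1 : V ∩ interior (M.cell K) ⊆ U ∩ Ω := fun y hy =>
    ⟨hVU hy.1, M.interior_cell_subset hΩ hc K hy.2⟩
  have hsub2 : V ∩ interior (M.cell K) ⊆ M.cell K := fun y hy => interior_subset hy.2
  have h1 := ae_mono (Measure.restrict_mono_set volume hsub1) hzero
  have h2 := ae_mono (Measure.restrict_mono_set volume hsub2)
    (hRT.combine_ae_eq hΩ hc (N.localCoeff (Pi.single (M.edge K i) 1)) K)
  have h3 : ∀ᵐ y ∂volume.restrict (V ∩ interior (M.cell K)), y ≠ M.W K i :=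
    ae_restrict_of_ae (Measure.ae_ne volume _)
  -- Vanishing near `x` would contradict the explicit form of the function at almost every point of
  -- an open set of positive measure.
  have h4 : ∀ᵐ y ∂volume.restrict (V ∩ interior (M.cell K)), False := by
    filter_upwards [h1, h2, h3, ae_restrict_mem hopen.measurableSet] with y hy1 hy2 hy3 hy
    rw [EdgeNormals.φ, N.assemble_eq_combine, hy2, Finset.sum_eq_single i] at hy1
    · rw [EdgeNormals.localCoeff, Pi.single_eq_same, mul_one, TriMesh.localRT,
        indicator_of_mem (hsub2 hy)] at hy1
      have := (M.area_pos K).ne'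
      rcases smul_eq_zero.1 hy1 with h5 | h5
      · exact N.ε_ne_zero K i h5
      · rcases smul_eq_zero.1 h5 with h6 | h6
        · simp [this] at h6
        · exact hy3 (sub_eq_zero.1 h6)
    · intro j _ hj
      rw [EdgeNormals.localCoeff, Pi.single_eq_of_ne fun h' => hj (M.edge_injective K h'), mul_zero,
        zero_smul]
    · simp
  rw [ae_iff] at h4
  simp only [not_false_eq_true, ofPred_true, Measure.restrict_apply_univ] at h4
  exact hpos.ne' h4

theorem isDualBasis_assemble (h : LocalFamily M g δ ψ) (hΩ : IsOpen Ω)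
    (hb : Bornology.IsBounded Ω) (hc : Convex ℝ Ω)
    (hacute : ∀ K i, 0 < M.θ K i ∧ M.θ K i < Real.pi / 2)
    (hg_one : ∫ s in (0 : ℝ)..1, g s = 1) (hg_sq : ∫ s in (0 : ℝ)..1, g s * s ^ 2 = 0)
    (hδ_sq : ∀ K i, ∫ x in M.cell K, δ K x * ‖x - M.W K i‖ ^ 2 = 0) (N : EdgeNormals M) :
    N.IsDualBasis (N.assemble ψ) ∧ ∀ a, l2 Ω (N.φ a) (N.assemble ψ a) = M.stiff a := by
  classical
  have hval : ∀ a b, l2 Ω (N.assemble ψ a) (N.φ b) = if a = b then M.stiff a else 0 := by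
    intro a b
    rw [EdgeNormals.φ, N.assemble_eq_combine, N.assemble_eq_combine,
      h.l2_combine_combine hΩ hc hg_one hg_sq hδ_sq, Finset.sum_eq_single a]
    · by_cases hab : a = b
      · subst hab; simp
      · simp [hab]
    · intro e _ he; simp [he]
    · simp
  refine ⟨⟨h.memHDiv_assemble hΩ hb hc N, fun a => ?_, fun a b hab => ?_,
    h.essSupport_assemble_subset hΩ hc N, h.hasFlux_assemble hΩ hc hg_one N⟩, fun a => ?_⟩
  · rw [hval, if_pos rfl]; exact (M.stiff_pos hacute a).ne'
  · rw [hval, if_neg hab]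
  · rw [l2_comm, hval, if_pos rfl]

end LocalFamily

/-! ### The discrete problem -/

namespace EdgeNormals

variable {T : Type*} [Fintype T] {Ω : Set Plane} {M : TriMesh T Ω} (N : EdgeNormals M)

open Classical in
/-- The jump of a piecewise constant function across an edge. -/
def jump (U : T → ℝ) (a : M.Edge) : ℝ :=
  ∑ K, ∑ i, if M.edge K i = a then N.ε K i * U K else 0

theorem jump_of_isBoundary (hΩ : IsOpen Ω) (hc : Convex ℝ Ω) (U : T → ℝ) {K : T} {i : Fin 3}
    (h : M.IsBoundary (M.edge K i)) : N.jump U (M.edge K i) = U K := by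
  rw [jump, sum_edge_of_isBoundary hΩ hc (fun K i => N.ε K i * U K) h, N.ε_of_isBoundary h, one_mul]

theorem jump_of_ne (U : T → ℝ) {K L : T} {i j : Fin 3} (hKL : K ≠ L)
    (he : M.edge K i = M.edge L j) : N.jump U (M.edge K i) = N.ε K i * (U K - U L) := by
  rw [jump, sum_edge_of_ne (fun K i => N.ε K i * U K) hKL he N, N.ε_eq_neg hKL he]
  ring

/-- Discrete integration by parts: the transpose of the divergence is the jump. -/
theorem sum_mul_localCoeff (U : T → ℝ) (P : M.Edge → ℝ) :
    ∑ K, U K * ∑ i, N.localCoeff P K i = ∑ a, P a * N.jump U a := by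
  classical
  simp only [jump, Finset.mul_sum, mul_ite, mul_zero]
  rw [sum_localized fun a K i => P a * (N.ε K i * U K)]
  refine Finset.sum_congr rfl fun K _ => Finset.sum_congr rfl fun i _ => ?_
  rw [localCoeff]; ring

/-- The outward flux of the identity through the boundary of a triangle is twice its area. -/
theorem exists_sum_localCoeff_eq_area : ∃ P : M.Edge → ℝ,
    ∀ K, ∑ i, N.localCoeff P K i = 2 * M.area K := by
  choose q hq using M.edge_surjective
  -- The flux of the identity through each edge, computed in an arbitrary triangle containing it;
  -- `hP` shows that the choice is irrelevant.
  let P : M.Edge → ℝ := fun a => edgeLength (M.tri (q a).1) (q a).2 *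
    ⟪N.n a, M.W (q a).1 ((q a).2 + 1)⟫
  have hP : ∀ K i, P (M.edge K i) =
      edgeLength (M.tri K) i * ⟪N.n (M.edge K i), M.W K (i + 1)⟫ := by
    intro K i
    have h := hq (M.edge K i)
    dsimp only at h
    have h1 := N.inner_W_eq_of_edge_eq h
    have h2 : edgeLength (M.tri (q (M.edge K i)).1) (q (M.edge K i)).2 =
        edgeLength (M.tri K) i := by
      rw [edgeLength, edgeLength]
      rcases M.edge_eq_iff.1 h with h3 | h3
      · simp only [TriMesh.W] at h3; rw [h3.1, h3.2]
      · simp only [TriMesh.W] at h3; rw [h3.1, h3.2, dist_comm]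
    simp only [P]
    rw [h] at h1
    rw [h2, h1]
  refine ⟨P, fun K => ?_⟩
  have h1 : ∀ i, N.localCoeff P K i = |orient (M.tri K)| / orient (M.tri K) *
      cross ((M.tri K).points (i + 1)) ((M.tri K).points (i + 2)) := by
    intro i
    rw [localCoeff, hP, ← edgeLength_mul_inner_normal (N.norm_ε_smul K i) (N.inner_ε_smul_edge K i)
      (N.inner_ε_smul_pos K i), inner_smul_left]
    simp only [TriMesh.W, conj_trivial]
    ring
  have harea : M.area K = |orient (M.tri K)| / 2 := volume_real_hull (M.tri K)
  simp only [h1]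
  rw [← Finset.mul_sum, sum_cross_points, div_mul_cancel₀ _ (orient_ne_zero _), harea]
  ring

/-- A piecewise constant function without jumps vanishes. -/
theorem eq_zero_of_jump_eq_zero (hΩ : IsOpen Ω) (hc : Convex ℝ Ω) {U : T → ℝ}
    (hU : ∀ a, N.jump U a = 0) : U = 0 := by
  -- Vanishing jumps pass to `U²`, a nonnegative function.
  have hU2 : ∀ a, N.jump (fun K => U K ^ 2) a = 0 := by
    intro a
    have ha := hU a
    rcases N.isBoundary_or_isInnerCoboundary hΩ a with ⟨hb, K, i, rfl⟩ | ⟨K, i, L, j, hin⟩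
    · rw [N.jump_of_isBoundary hΩ hc _ hb] at ha ⊢
      rw [ha]; ring
    · have hKL := N.ne_of_isInnerCoboundary hin
      obtain ⟨-, rfl, h2, -, -⟩ := hin
      rw [N.jump_of_ne _ hKL h2.symm] at ha ⊢
      linear_combination (U K + U L) * ha
  -- Integrating `U²` by parts against a discrete field of constant positive divergence gives `∑
  -- U_K² · 2|K| = 0`; no connectedness of the mesh is involved.
  obtain ⟨P, hP⟩ := N.exists_sum_localCoeff_eq_area
  have h := N.sum_mul_localCoeff (fun K => U K ^ 2) P
  simp only [hP, hU2, mul_zero, Finset.sum_const_zero] at h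
  have hnn : ∀ K ∈ Finset.univ, 0 ≤ U K ^ 2 * (2 * M.area K) := fun K _ =>
    mul_nonneg (sq_nonneg _) (by linarith [M.area_pos K])
  ext K
  have hK := (Finset.sum_eq_zero_iff_of_nonneg hnn).1 h K (Finset.mem_univ K)
  have ha := (M.area_pos K).ne'
  simpa [ha] using hK

/-- The discrete system for the unknowns `U` on the triangles and `P` on the edges. -/
def IsSolution (b : T → ℝ) (U : T → ℝ) (P : M.Edge → ℝ) : Prop :=
  (∀ a, P a * M.stiff a + N.jump U a = 0) ∧ ∀ K, -∑ i, N.localCoeff P K i = b K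

theorem jump_add (U V : T → ℝ) (a : M.Edge) : N.jump (U + V) a = N.jump U a + N.jump V a := by
  classical
  simp only [jump, ← Finset.sum_add_distrib]
  refine Finset.sum_congr rfl fun K _ => Finset.sum_congr rfl fun i _ => ?_
  split_ifs
  · rw [Pi.add_apply]; ring
  · ring

theorem jump_smul (r : ℝ) (U : T → ℝ) (a : M.Edge) : N.jump (r • U) a = r * N.jump U a := by
  classical
  simp only [jump, Finset.mul_sum]
  refine Finset.sum_congr rfl fun K _ => Finset.sum_congr rfl fun i _ => ?_
  split_ifs
  · rw [Pi.smul_apply, smul_eq_mul]; ring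
  · ring

/-- The operator of the finite volume scheme. -/
def schemeOperator : (T → ℝ) →ₗ[ℝ] (T → ℝ) where
  toFun U K := ∑ i, N.localCoeff (fun a => N.jump U a / M.stiff a) K i
  map_add' U V := by
    ext K
    rw [Pi.add_apply, ← Finset.sum_add_distrib]
    refine Finset.sum_congr rfl fun i _ => ?_
    simp only [localCoeff, jump_add]; ring
  map_smul' r U := by
    ext K
    rw [Pi.smul_apply, smul_eq_mul, Finset.mul_sum]
    refine Finset.sum_congr rfl fun i _ => ?_
    simp only [localCoeff, jump_smul, RingHom.id_apply]; ring

/-- Diagonality of the pairing makes the elimination of `P` explicit, edge by edge. -/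
theorem isSolution_iff (hs : ∀ a, 0 < M.stiff a) (b U : T → ℝ) (P : M.Edge → ℝ) :
    N.IsSolution b U P ↔ (∀ a, P a = -(N.jump U a / M.stiff a)) ∧ N.schemeOperator U = b := by
  have h1 : (∀ a, P a * M.stiff a + N.jump U a = 0) ↔ ∀ a, P a = -(N.jump U a / M.stiff a) := by
    refine forall_congr' fun a => ?_
    rw [← neg_div, eq_div_iff (hs a).ne', eq_neg_iff_add_eq_zero]
  rw [IsSolution, h1]
  refine and_congr_right fun hP => ?_
  rw [funext_iff]
  refine forall_congr' fun K => ?_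
  have : -∑ i, N.localCoeff P K i = N.schemeOperator U K := by
    change _ = ∑ i, N.localCoeff (fun a => N.jump U a / M.stiff a) K i
    rw [← Finset.sum_neg_distrib]
    refine Finset.sum_congr rfl fun i _ => ?_
    simp only [localCoeff, hP]; ring
  rw [this]

/-- Energy argument: tested with `U`, the operator gives the sum of `jump² / stiff`. In the kernel
all jumps vanish, so `U = 0`; surjectivity follows by dimension. -/
theorem schemeOperator_bijective (hΩ : IsOpen Ω) (hc : Convex ℝ Ω) (hs : ∀ a, 0 < M.stiff a) :
    Function.Bijective N.schemeOperator := by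
  have hinj : Function.Injective N.schemeOperator := by
    rw [injective_iff_map_eq_zero]
    intro U hU
    apply N.eq_zero_of_jump_eq_zero hΩ hc
    have h := N.sum_mul_localCoeff U fun a => N.jump U a / M.stiff a
    have h0 : ∀ K, ∑ i, N.localCoeff (fun a => N.jump U a / M.stiff a) K i = 0 :=
      fun K => congrFun hU K
    simp only [h0, mul_zero, Finset.sum_const_zero] at h
    have hnn : ∀ a ∈ Finset.univ, 0 ≤ N.jump U a / M.stiff a * N.jump U a := fun a _ => by
      rw [div_mul_eq_mul_div]
      exact div_nonneg (mul_self_nonneg _) (hs a).le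
    intro a
    have ha := (Finset.sum_eq_zero_iff_of_nonneg hnn).1 h.symm a (Finset.mem_univ a)
    simpa [(hs a).ne'] using ha
  exact ⟨hinj, LinearMap.injective_iff_surjective.1 hinj⟩

/-! ### The finite volume scheme -/

theorem center_eq (K : T) (i : Fin 3) : M.center K = edgeMid (M.tri K) i -
    (edgeLength (M.tri K) i * (Real.cot (M.θ K i) / 2)) • (N.ε K i • N.n (M.edge K i)) :=
  circumcenter_eq (N.norm_ε_smul K i) (N.inner_ε_smul_edge K i) (N.inner_ε_smul_pos K i)

theorem edgeLength_eq_of_edge_eq {K L : T} {i j : Fin 3} (he : M.edge K i = M.edge L j) :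
    edgeLength (M.tri K) i = edgeLength (M.tri L) j := by
  rw [edgeLength, edgeLength]
  rcases M.edge_eq_iff.1 he with h3 | h3
  · simp only [TriMesh.W] at h3; rw [h3.1, h3.2]
  · simp only [TriMesh.W] at h3; rw [h3.1, h3.2, dist_comm]

/-- Both circumcenters lie on the normal through the common midpoint, and the opposite signs turn
the difference of the signed distances into a sum of cotangents. -/
theorem dist_center (N : EdgeNormals M) (hs : ∀ a, 0 < M.stiff a) {K L : T} {i j : Fin 3} (hKL : K ≠ L)
    (he : M.edge K i = M.edge L j) :
    dist (M.center K) (M.center L) = edgeLength (M.tri K) i * M.stiff (M.edge K i) := by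
  have hpos := mul_pos (edgeLength_pos (M.tri K) i) (hs (M.edge K i))
  have hst := M.stiff_of_ne N hKL he
  have hL := N.center_eq L j
  rw [← edgeLength_eq_of_edge_eq he, ← M.edgeMid_eq_of_edge_eq he, ← he, N.ε_eq_neg hKL he] at hL
  have hsub : M.center K - M.center L =
      (-(edgeLength (M.tri K) i * M.stiff (M.edge K i))) • (N.ε K i • N.n (M.edge K i)) := by
    rw [N.center_eq K i, hL, hst]; module
  rw [dist_eq_norm, hsub, norm_smul, N.norm_ε_smul, mul_one, norm_neg, Real.norm_of_nonneg hpos.le]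

theorem infDist_center (N : EdgeNormals M) (hs : ∀ a, 0 < M.stiff a) (hΩ : IsOpen Ω) (hc : Convex ℝ Ω) {K : T}
    {i : Fin 3} (h : M.IsBoundary (M.edge K i)) :
    Metric.infDist (M.center K) (M.seg (M.edge K i)) =
      edgeLength (M.tri K) i * M.stiff (M.edge K i) := by
  have hpos := mul_pos (edgeLength_pos (M.tri K) i) (hs (M.edge K i))
  have hcen := N.center_eq K i
  rw [← M.stiff_of_isBoundary hΩ hc h] at hcen
  have hmem := M.edgeMid_mem_seg K i
  have hn := N.norm_ε_smul K i
  have hperp := N.inner_ε_smul_edge K i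
  set ν := N.ε K i • N.n (M.edge K i)
  apply le_antisymm
  · refine (Metric.infDist_le_dist_of_mem hmem).trans (le_of_eq ?_)
    rw [dist_eq_norm, hcen, sub_sub_cancel_left, norm_neg, norm_smul, hn, mul_one,
      Real.norm_of_nonneg hpos.le]
  · refine (Metric.le_infDist ⟨_, hmem⟩).2 fun y hy => ?_
    rw [M.seg_edge] at hy
    obtain ⟨s, t, -, -, hst, rfl⟩ := hy
    rw [dist_comm, dist_eq_norm]
    -- Lower bound by projection on the normal: the component along the edge drops out, so all
    -- points of the edge have the same projection.
    have hle := real_inner_le_norm ν (s • M.W K (i + 1) + t • M.W K (i + 2) - M.center K)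
    rw [hn, one_mul] at hle
    refine le_trans (le_of_eq ?_) hle
    have hy : s • M.W K (i + 1) + t • M.W K (i + 2) - M.center K =
        (s - 2⁻¹) • (M.W K (i + 1) - M.W K (i + 2)) +
          (edgeLength (M.tri K) i * M.stiff (M.edge K i)) • ν := by
      rw [hcen, edgeMid, show t = 1 - s by linarith]
      simp only [TriMesh.W]
      module
    rw [hy, inner_add_right, inner_smul_right, inner_smul_right, hperp,
      real_inner_self_eq_norm_sq, hn]
    ring

theorem isSolution_iff_isVF4 (hs : ∀ a, 0 < M.stiff a) (hΩ : IsOpen Ω) (hc : Convex ℝ Ω)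
    (f : Plane → ℝ) (U : T → ℝ) (P : M.Edge → ℝ) :
    N.IsSolution (fun K => ∫ x in M.cell K, f x) U P ↔
      M.IsVF4 f U (fun K i => -(N.ε K i * P (M.edge K i))) := by
  have hinner : ∀ {K L : T} {i j : Fin 3}, K ≠ L → M.edge K i = M.edge L j →
      (-(N.ε K i * P (M.edge K i)) = -(edgeLength (M.tri K) i *
        ((U L - U K) / dist (M.center K) (M.center L))) ↔
      P (M.edge K i) * M.stiff (M.edge K i) + N.jump U (M.edge K i) = 0) := by
    intro K L i j hKL he
    have hl := (edgeLength_pos (M.tri K) i).ne'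
    have hst := (hs (M.edge K i)).ne'
    have hε := N.ε_mul_self K i
    rw [N.dist_center hs hKL he, N.jump_of_ne U hKL he]
    -- The distance carries a factor `|a|`, so the transmissibility `|a| / |x_K - x_L|` is the
    -- inverse of `stiff`.
    have e : edgeLength (M.tri K) i * ((U L - U K) / (edgeLength (M.tri K) i * M.stiff (M.edge K i))) =
        (U L - U K) / M.stiff (M.edge K i) := by field_simp
    rw [e, neg_inj, eq_div_iff hst]
    constructor
    · intro h
      linear_combination N.ε K i * h - P (M.edge K i) * M.stiff (M.edge K i) * hε
    · intro h
      linear_combination N.ε K i * h - (U K - U L) * hε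
  have hbdry : ∀ {K : T} {i : Fin 3}, M.IsBoundary (M.edge K i) →
      (-(N.ε K i * P (M.edge K i)) = -(edgeLength (M.tri K) i *
        ((0 - U K) / Metric.infDist (M.center K) (M.seg (M.edge K i)))) ↔
      P (M.edge K i) * M.stiff (M.edge K i) + N.jump U (M.edge K i) = 0) := by
    intro K i hb
    have hl := (edgeLength_pos (M.tri K) i).ne'
    have hst := (hs (M.edge K i)).ne'
    rw [N.infDist_center hs hΩ hc hb, N.jump_of_isBoundary hΩ hc U hb, N.ε_of_isBoundary hb]
    have e : edgeLength (M.tri K) i * ((0 - U K) / (edgeLength (M.tri K) i * M.stiff (M.edge K i))) =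
        (0 - U K) / M.stiff (M.edge K i) := by field_simp
    rw [e, neg_inj, eq_div_iff hst]
    constructor <;> intro h <;> linarith
  rw [IsSolution, TriMesh.IsVF4, ← and_assoc]
  refine and_congr ⟨fun h => ⟨fun K i L j hKL he => (hinner hKL he).2 (h _),
    fun K i hb => (hbdry hb).2 (h _)⟩, fun h a => ?_⟩ ?_
  · rcases N.isBoundary_or_isInnerCoboundary hΩ a with ⟨hb, K, i, rfl⟩ | ⟨K, i, L, j, hin⟩
    · exact (hbdry hb).1 (h.2 K i hb)
    · have hKL := N.ne_of_isInnerCoboundary hin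
      obtain ⟨-, rfl, h2, -, -⟩ := hin
      exact (hinner hKL h2.symm).1 (h.1 K i L j hKL h2.symm)
  · simp only [localCoeff, Finset.sum_neg_distrib]

end EdgeNormals

/-! ### Equivalence of the discrete problems -/

namespace LocalFamily

variable {T : Type*} [Fintype T] {Ω : Set Plane} {M : TriMesh T Ω} {g : ℝ → ℝ}
  {δ : T → Plane → ℝ} {ψ : T → Fin 3 → Plane → Plane}

/-- A local family given by normal traces. -/
theorem of_hasNormalTrace (hg : IntervalIntegrable g volume 0 1)
    (hg_symm : ∀ s ∈ Ioo (0 : ℝ) 1, g s = g (1 - s))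
    (hδ : ∀ K, MemLp (δ K) 2 (volume.restrict (M.cell K)))
    (hδ_one : ∀ K, ∫ x in M.cell K, δ K x = 1)
    (hψ : ∀ K i, MemLp (ψ K i) 2 (volume.restrict (M.cell K)))
    (hψ_zero : ∀ K i, ∀ᵐ x ∂(volume.restrict (Ω \ M.cell K)), ψ K i x = 0)
    (hψ_div : ∀ K i, IsWeakDiv (interior (M.cell K)) (ψ K i) (δ K))
    (hψ_trace : ∀ K i, HasNormalTrace (M.tri K) (ψ K i)
      (fun j s => if j = i then g s / edgeLength (M.tri K) i else 0)) :
    LocalFamily M g δ ψ where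
  memLp := hψ
  ae_zero := hψ_zero
  memLp_div := hδ
  integrable := hg
  symm := hg_symm
  integral_div := hδ_one
  green K i v hv := by
    obtain ⟨-, d, hd, hdiv, hgreen⟩ := hψ_trace K i
    have hae : interior (hull (M.tri K)) =ᵐ[volume] M.cell K := interior_hull_ae_eq (M.tri K)
    have hδ' : MemLp (δ K) 2 (volume.restrict (interior (hull (M.tri K)))) := by
      rw [Measure.restrict_congr_set hae]; exact hδ K
    -- The divergence hidden in the normal trace is unspecified; uniqueness identifies it with `δ
    -- K`.
    have heq := IsWeakDiv.ae_eq isOpen_interior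
      ((isCompact_hull (M.tri K)).isBounded.subset interior_subset) hd hδ' hdiv (hψ_div K i)
    have h := hgreen v hv
    have h1 : ∫ x in interior (hull (M.tri K)), d x * v x =
        ∫ x in interior (hull (M.tri K)), δ K x * v x := by
      refine integral_congr_ae ?_
      filter_upwards [heq] with x hx
      rw [hx]
    rw [h1, setIntegral_congr_set hae, setIntegral_congr_set hae, Finset.sum_eq_single i] at h
    · rw [h, ← intervalIntegral.integral_const_mul]
      refine intervalIntegral.integral_congr fun s _ => ?_
      have := (edgeLength_pos (M.tri K) i).ne'
      simp only [if_true]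
      field_simp
    · intro j _ hj
      simp [hj]
    · simp

section Discrete

variable {N : EdgeNormals M}

theorem mem_P0_iff {u : Plane → ℝ} : u ∈ M.P0 ↔ ∃ U : T → ℝ, ∑ K, U K • M.ind K = u :=
  Submodule.mem_span_range_iff_exists_fun ℝ

theorem mem_span_assemble_iff {χ : T → Fin 3 → Plane → Plane} {p : Plane → Plane} :
    p ∈ Submodule.span ℝ (range (N.assemble χ)) ↔
      ∃ P : M.Edge → ℝ, combine χ (N.localCoeff P) = p := by
  rw [Submodule.mem_span_range_iff_exists_fun]
  simp only [N.sum_smul_assemble]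

theorem integral_div_localRT (hΩ : IsOpen Ω) (hb : Bornology.IsBounded Ω) (hc : Convex ℝ Ω)
    (N : EdgeNormals M) (P : M.Edge → ℝ) (K : T) :
    ∫ x in M.cell K, div Ω (combine M.localRT (N.localCoeff P)) x = ∑ i, N.localCoeff P K i := by
  have hRT := M.localFamily_localRT hΩ
  have h1 := ae_mono (M.restrict_cell_le hΩ hc K) (hRT.div_combine_ae_eq hΩ hb hc N P)
  rw [integral_congr_ae h1, TriMesh.combineDiv, M.setIntegral_cell_sum_indicator,
    hRT.integral_div, mul_one]

theorem memLp_div_localRT (hΩ : IsOpen Ω) (hb : Bornology.IsBounded Ω) (hc : Convex ℝ Ω)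
    (N : EdgeNormals M) (P : M.Edge → ℝ) :
    MemLp (div Ω (combine M.localRT (N.localCoeff P))) 2 (volume.restrict Ω) :=
  have hRT := M.localFamily_localRT hΩ
  (hRT.memLp_combineDiv hΩ hc _).ae_eq (hRT.div_combine_ae_eq hΩ hb hc N P).symm

theorem sum_mul_single [DecidableEq M.Edge] (F : M.Edge → ℝ) (a : M.Edge) :
    ∑ b, (Pi.single a 1 : M.Edge → ℝ) b * F b = F a := by
  rw [Finset.sum_eq_single a]
  · simp
  · intro b _ hb; simp [hb]
  · simp

/-- Diagonal pairing and discrete integration by parts turn the first equation into a combination of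
the edge equations, with the coefficients of the test field as weights. -/
theorem isPetrovGalerkin_iff (h : LocalFamily M g δ ψ) (hΩ : IsOpen Ω) (hb : Bornology.IsBounded Ω)
    (hc : Convex ℝ Ω) (hg_one : ∫ s in (0 : ℝ)..1, g s = 1)
    (hg_sq : ∫ s in (0 : ℝ)..1, g s * s ^ 2 = 0)
    (hδ_sq : ∀ K i, ∫ x in M.cell K, δ K x * ‖x - M.W K i‖ ^ 2 = 0)
    {f : Plane → ℝ} (hf : MemLp f 2 (volume.restrict Ω)) (U : T → ℝ) (P : M.Edge → ℝ) :
    N.IsPetrovGalerkin (N.assemble ψ) f (∑ K, U K • M.ind K)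
        (combine M.localRT (N.localCoeff P)) ↔
      N.IsSolution (fun K => ∫ x in M.cell K, f x) U P := by
  classical
  have e1 : ∀ R : M.Edge → ℝ,
      l2 Ω (combine M.localRT (N.localCoeff P)) (combine ψ (N.localCoeff R)) +
        l2 Ω (∑ K, U K • M.ind K) (div Ω (combine ψ (N.localCoeff R))) =
      ∑ a, R a * (P a * M.stiff a + N.jump U a) := by
    intro R
    rw [l2_comm, h.l2_combine_combine hΩ hc hg_one hg_sq hδ_sq, h.l2_sum_ind_div hΩ hb hc,
      N.sum_mul_localCoeff, ← Finset.sum_add_distrib]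
    exact Finset.sum_congr rfl fun a _ => by ring
  have e2 : ∀ V : T → ℝ,
      -l2 Ω (div Ω (combine M.localRT (N.localCoeff P))) (∑ K, V K • M.ind K) =
        ∑ K, V K * -∑ i, N.localCoeff P K i := by
    intro V
    rw [M.l2_sum_ind hΩ hc (memLp_div_localRT hΩ hb hc N P), ← Finset.sum_neg_distrib]
    simp only [integral_div_localRT hΩ hb hc N, mul_neg]
  constructor
  · rintro ⟨-, -, hall⟩
    refine ⟨fun a => ?_, fun K => ?_⟩
    · have := (hall 0 (Submodule.zero_mem _) (combine ψ (N.localCoeff (Pi.single a 1)))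
        (mem_span_assemble_iff.2 ⟨_, rfl⟩)).1
      rwa [e1, sum_mul_single] at this
    · have := (hall (∑ L, (Pi.single K 1 : T → ℝ) L • M.ind L) (mem_P0_iff.2 ⟨_, rfl⟩) 0
        (Submodule.zero_mem _)).2
      rw [e2, M.l2_sum_ind hΩ hc hf, Finset.sum_eq_single K, Finset.sum_eq_single K] at this
      · simpa using this
      · intro L _ hL; simp [hL]
      · simp
      · intro L _ hL; simp [hL]
      · simp
  · rintro ⟨h1, h2⟩
    refine ⟨mem_P0_iff.2 ⟨U, rfl⟩, mem_span_assemble_iff.2 ⟨P, rfl⟩, fun v hv q hq => ?_⟩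
    obtain ⟨V, rfl⟩ := mem_P0_iff.1 hv
    obtain ⟨R, rfl⟩ := mem_span_assemble_iff.1 hq
    rw [e1, e2, M.l2_sum_ind hΩ hc hf]
    simp [h1, h2]

/-- The pairing is diagonal and both families have the same discrete divergence, so testing with
`RT` gives the same edge equations as testing the mixed problem with `RT*`. -/
theorem gradient_iff (h : LocalFamily M g δ ψ) (hΩ : IsOpen Ω) (hb : Bornology.IsBounded Ω)
    (hc : Convex ℝ Ω) (hg_one : ∫ s in (0 : ℝ)..1, g s = 1)
    (hg_sq : ∫ s in (0 : ℝ)..1, g s * s ^ 2 = 0)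
    (hδ_sq : ∀ K i, ∫ x in M.cell K, δ K x * ‖x - M.W K i‖ ^ 2 = 0) (U : T → ℝ)
    (P : M.Edge → ℝ) :
    (∀ q ∈ N.RT, l2 Ω (combine ψ (N.localCoeff P)) q = -l2 Ω (∑ K, U K • M.ind K) (div Ω q)) ↔
      ∀ a, P a * M.stiff a + N.jump U a = 0 := by
  classical
  have hRT := M.localFamily_localRT hΩ
  have e1 : ∀ R : M.Edge → ℝ,
      (l2 Ω (combine ψ (N.localCoeff P)) (combine M.localRT (N.localCoeff R)) =
        -l2 Ω (∑ K, U K • M.ind K) (div Ω (combine M.localRT (N.localCoeff R)))) ↔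
      ∑ a, R a * (P a * M.stiff a + N.jump U a) = 0 := by
    intro R
    rw [h.l2_combine_combine hΩ hc hg_one hg_sq hδ_sq, hRT.l2_sum_ind_div hΩ hb hc,
      N.sum_mul_localCoeff, eq_neg_iff_add_eq_zero, ← Finset.sum_add_distrib]
    refine Eq.congr (Finset.sum_congr rfl fun a _ => by ring) rfl
  constructor
  · intro hall a
    have := (e1 _).1 (hall (combine M.localRT (N.localCoeff (Pi.single a 1)))
      (mem_span_assemble_iff.2 ⟨_, rfl⟩))
    rwa [sum_mul_single] at this
  · intro h1 q hq
    obtain ⟨R, rfl⟩ := mem_span_assemble_iff.1 hq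
    exact (e1 R).2 (by simp [h1])

theorem div_eq_proj_iff (hΩ : IsOpen Ω) (hb : Bornology.IsBounded Ω) (hc : Convex ℝ Ω)
    (N : EdgeNormals M) (f : Plane → ℝ) (P : M.Edge → ℝ) :
    (∀ᵐ x ∂(volume.restrict Ω), -div Ω (combine M.localRT (N.localCoeff P)) x = M.proj f x) ↔
      ∀ K, -∑ i, N.localCoeff P K i = ∫ x in M.cell K, f x := by
  have hRT := M.localFamily_localRT hΩ
  constructor
  · intro hae K
    have h1 := integral_congr_ae (ae_mono (M.restrict_cell_le hΩ hc K) hae)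
    rw [integral_neg, integral_div_localRT hΩ hb hc N] at h1
    rw [h1]
    have h2 := M.setIntegral_cell_sum_indicator (δ := fun _ => 1)
      (fun K => (M.area K)⁻¹ * ∫ x in M.cell K, f x) K
    refine h2.trans ?_
    have h3 : ∫ x in M.cell K, (1 : Plane → ℝ) x = M.area K := by
      simp [TriMesh.area]
    have := (M.area_pos K).ne'
    rw [h3]
    field_simp
  · intro hK
    filter_upwards [hRT.div_combine_ae_eq hΩ hb hc N P] with x hx
    -- Both sides combine the same indicator functions, so points shared by several triangles need
    -- no separate treatment.
    rw [hx, TriMesh.combineDiv, TriMesh.proj, Finset.sum_apply, Finset.sum_apply,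
      ← Finset.sum_neg_distrib]
    refine Finset.sum_congr rfl fun K _ => ?_
    rw [← hK K, Pi.smul_apply, Pi.smul_apply, TriMesh.ind]
    by_cases hxK : x ∈ M.cell K
    · rw [indicator_of_mem hxK, indicator_of_mem hxK]
      simp only [smul_eq_mul, Pi.one_apply]
      ring
    · rw [indicator_of_notMem hxK, indicator_of_notMem hxK]
      simp

theorem isPetrovGalerkin_iff_isDiscretePoisson (h : LocalFamily M g δ ψ) (hΩ : IsOpen Ω)
    (hb : Bornology.IsBounded Ω) (hc : Convex ℝ Ω) (hg_one : ∫ s in (0 : ℝ)..1, g s = 1)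
    (hg_sq : ∫ s in (0 : ℝ)..1, g s * s ^ 2 = 0)
    (hδ_sq : ∀ K i, ∫ x in M.cell K, δ K x * ‖x - M.W K i‖ ^ 2 = 0)
    {f : Plane → ℝ} (hf : MemLp f 2 (volume.restrict Ω)) (u : Plane → ℝ) (p : Plane → Plane) :
    N.IsPetrovGalerkin (N.assemble ψ) f u p ↔ N.IsDiscretePoisson (N.assemble ψ) f u p := by
  constructor
  · intro hpg
    obtain ⟨U, rfl⟩ := mem_P0_iff.1 hpg.1
    obtain ⟨P, rfl⟩ := mem_span_assemble_iff.1 hpg.2.1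
    have hsol := (h.isPetrovGalerkin_iff hΩ hb hc hg_one hg_sq hδ_sq hf U P).1 hpg
    refine ⟨hpg.1, ⟨P, (N.sum_smul_assemble M.localRT P).symm, ?_⟩,
      (div_eq_proj_iff hΩ hb hc N f P).2 hsol.2⟩
    rw [N.sum_smul_assemble]
    exact (h.gradient_iff hΩ hb hc hg_one hg_sq hδ_sq U P).2 hsol.1
  · rintro ⟨hu, ⟨P, hp, hgrad⟩, hdiv⟩
    obtain ⟨U, rfl⟩ := mem_P0_iff.1 hu
    have hp' : p = combine M.localRT (N.localCoeff P) :=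
      hp.trans (N.sum_smul_assemble M.localRT P)
    subst hp'
    rw [N.sum_smul_assemble] at hgrad
    exact (h.isPetrovGalerkin_iff hΩ hb hc hg_one hg_sq hδ_sq hf U P).2
      ⟨(h.gradient_iff hΩ hb hc hg_one hg_sq hδ_sq U P).1 hgrad,
        (div_eq_proj_iff hΩ hb hc N f P).1 hdiv⟩

theorem existsUnique_isPetrovGalerkin (h : LocalFamily M g δ ψ) (hΩ : IsOpen Ω)
    (hb : Bornology.IsBounded Ω) (hc : Convex ℝ Ω)
    (hacute : ∀ K i, 0 < M.θ K i ∧ M.θ K i < Real.pi / 2)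
    (hg_one : ∫ s in (0 : ℝ)..1, g s = 1) (hg_sq : ∫ s in (0 : ℝ)..1, g s * s ^ 2 = 0)
    (hδ_sq : ∀ K i, ∫ x in M.cell K, δ K x * ‖x - M.W K i‖ ^ 2 = 0)
    {f : Plane → ℝ} (hf : MemLp f 2 (volume.restrict Ω)) (N : EdgeNormals M) :
    ∃! up : (Plane → ℝ) × (Plane → Plane), N.IsPetrovGalerkin (N.assemble ψ) f up.1 up.2 := by
  have hs := M.stiff_pos hacute
  have hbij := N.schemeOperator_bijective hΩ hc hs
  obtain ⟨U, hU⟩ := hbij.2 fun K => ∫ x in M.cell K, f x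
  refine ⟨(∑ K, U K • M.ind K,
    combine M.localRT (N.localCoeff fun a => -(N.jump U a / M.stiff a))), ?_, ?_⟩
  · exact (h.isPetrovGalerkin_iff hΩ hb hc hg_one hg_sq hδ_sq hf U _).2
      ((N.isSolution_iff hs _ _ _).2 ⟨fun _ => rfl, hU⟩)
  · rintro ⟨u, p⟩ hpg
    obtain ⟨U', rfl⟩ := mem_P0_iff.1 hpg.1
    obtain ⟨P', hP'⟩ := mem_span_assemble_iff.1 hpg.2.1
    dsimp only at hP' hpg ⊢
    subst hP'
    obtain ⟨h1, h2⟩ := (N.isSolution_iff hs _ _ _).1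
      ((h.isPetrovGalerkin_iff hΩ hb hc hg_one hg_sq hδ_sq hf U' P').1 hpg)
    -- Injectivity fixes the cell values and the edge equations then fix `P`; equal coefficients
    -- give equality of functions everywhere, not only almost everywhere.
    obtain rfl : U' = U := hbij.1 (h2.trans hU.symm)
    rw [funext h1]

end Discrete

end LocalFamily

end

end RTPG

theorem theorem1 {T : Type*} [Fintype T] (Ω : Set Plane)
    (hΩ_open : IsOpen Ω) (hΩ_bdd : Bornology.IsBounded Ω) (hΩ_conv : Convex ℝ Ω)
    (M : TriMesh T Ω) (N : EdgeNormals M)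
    (hacute : ∀ K i, 0 < M.θ K i ∧ M.θ K i < Real.pi / 2)
    -- the function `g` on `(0, 1)`
    (g : ℝ → ℝ) (hg : IntervalIntegrable g volume 0 1)
    (hg_one : ∫ s in (0 : ℝ)..1, g s = 1)
    (hg_sq : ∫ s in (0 : ℝ)..1, g s * s ^ 2 = 0)
    (hg_symm : ∀ s ∈ Set.Ioo (0 : ℝ) 1, g s = g (1 - s))
    -- the functions `δ_K`
    (δ : T → Plane → ℝ)
    (hδ : ∀ K, MemLp (δ K) 2 (volume.restrict (M.cell K)))
    (hδ_one : ∀ K, ∫ x in M.cell K, δ K x = 1)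
    (hδ_sq : ∀ K i, ∫ x in M.cell K, δ K x * ‖x - M.W K i‖ ^ 2 = 0)
    -- the local fields
    (ψ : T → Fin 3 → Plane → Plane)
    (hψ : ∀ K i, MemLp (ψ K i) 2 (volume.restrict (M.cell K)))
    (hψ_zero : ∀ K i, ∀ᵐ x ∂(volume.restrict (Ω \ M.cell K)), ψ K i x = 0)
    (hψ_div : ∀ K i, IsWeakDiv (interior (M.cell K)) (ψ K i) (δ K))
    (hψ_trace : ∀ K i, HasNormalTrace (M.tri K) (ψ K i)
      (fun j s => if j = i then g s / edgeLength (M.tri K) i else 0)) :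
    -- the assembled family is a Raviart-Thomas dual basis
    N.IsDualBasis (N.assemble ψ) ∧
    -- the coefficients `(φ_a, φ*_a)₀`
    (∀ a K i L j, N.IsInnerCoboundary a K i L j →
      l2 Ω (N.φ a) (N.assemble ψ a) = (Real.cot (M.θ K i) + Real.cot (M.θ L j)) / 2) ∧
    (∀ a K i, M.IsBoundary a → M.edge K i = a →
      l2 Ω (N.φ a) (N.assemble ψ a) = Real.cot (M.θ K i) / 2) ∧
    -- the discrete Poisson problem
    ∀ f : Plane → ℝ, MemLp f 2 (volume.restrict Ω) →
      (∃! up : (Plane → ℝ) × (Plane → Plane), N.IsPetrovGalerkin (N.assemble ψ) f up.1 up.2) ∧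
      (∀ u p, N.IsPetrovGalerkin (N.assemble ψ) f u p ↔
        N.IsDiscretePoisson (N.assemble ψ) f u p) ∧
      -- it is the `VF4` scheme
      ∀ (U : T → ℝ) (P : M.Edge → ℝ),
        N.IsPetrovGalerkin (N.assemble ψ) f (∑ K, U K • M.ind K) (∑ a, P a • N.φ a) ↔
          M.IsVF4 f U (fun K i => -(N.ε K i * P (M.edge K i))) := by
  classical
  have h := LocalFamily.of_hasNormalTrace hg hg_symm hδ hδ_one hψ hψ_zero hψ_div hψ_trace
  obtain ⟨hdual, hval⟩ :=
    h.isDualBasis_assemble hΩ_open hΩ_bdd hΩ_conv hacute hg_one hg_sq hδ_sq N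
  refine ⟨hdual, fun a K i L j hin => ?_, fun a K i hb ha => ?_, fun f hf => ⟨?_, ?_, ?_⟩⟩
  · have hKL := N.ne_of_isInnerCoboundary hin
    obtain ⟨-, rfl, h2, -, -⟩ := hin
    rw [hval, M.stiff_of_ne N hKL h2.symm]
  · subst ha
    rw [hval, M.stiff_of_isBoundary hΩ_open hΩ_conv hb]
  · exact h.existsUnique_isPetrovGalerkin hΩ_open hΩ_bdd hΩ_conv hacute hg_one hg_sq hδ_sq hf N
  · exact h.isPetrovGalerkin_iff_isDiscretePoisson hΩ_open hΩ_bdd hΩ_conv hg_one hg_sq hδ_sq hf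
  · intro U P
    rw [← N.isSolution_iff_isVF4 (M.stiff_pos hacute) hΩ_open hΩ_conv,
      ← h.isPetrovGalerkin_iff hΩ_open hΩ_bdd hΩ_conv hg_one hg_sq hδ_sq hf,
      ← N.sum_smul_assemble]
    rfl
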